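/- Consider the one-dimensional pursuit–evasion game with computable initial positions $x_0<y_0$ on the real line: Pursuer, using a control function $u:\mathbb R\to\mathbb R$, is at time $t\ge 0$ at $x(t)=x_0+\int_0^t u(s)\,ds$, and Evader, using a control function $v:\mathbb R\to\mathbb R$, is at time $t$ at $y(t)=y_0+\int_0^t v(s)\,ds$. Evader wins playing $v$ against $u$ if $x(t)\neq y(t)$ for all $t\ge 0$. A real $x$ is represented by $\phi:\mathbb N\to\mathbb Q$ if $|x-\phi(k)|\le 2^{-k}$ for all $k$, and it is computable if it has a computable representation. A sequence $(f_n)_{n\in\mathbb N}$ of functions $\mathbb R\to\mathbb R$ is computable if there is one oracle machine which, for all $x\in\mathbb R$, every representation of $x$ given as oracle, and all inputs $n,k\in\mathbb N$, outputs a rational $y$ with $|f_n(x)-y|<2^{-k}$. For any pair of computable sequences $(u_n)_{n\in\mathbb N}$, $(v_n)_{n\in\mathbb N}$ of strategies for Pursuer and Evader, respectively, the set $E$ of those indices $n$ for which Evader wins playing $v_n$ against Pursuer playing $u_n$ is $\Pi^0_2$. Moreover, there is a pair of computable sequences $(u_n)$, $(v_n)$ for which $E$ is $\Pi^0_2$-complete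 (under many-one reductions); in particular, this $E$ is not decidable. -/

import Mathlib

namespace PursuitEvasion

/-! ### Oracle machines -/

/-- Programs of oracle machines, in the form of codes for partial recursive functions with an
additional instruction that queries the oracle. The clauses are those of Mathlib's
`Nat.RecursiveIn`; as codes, they allow one fixed program to be run with varying oracles. -/
inductive OracleCode : Type
  | zero : OracleCode
  | succ : OracleCode
  | left : OracleCode
  | right : OracleCode
  | oracle : OracleCode
  | pair : OracleCode → OracleCode → OracleCode
  | comp : OracleCode → OracleCode → OracleCode
  | prec : OracleCode → OracleCode → OracleCode
  | rfind : OracleCode → OracleCode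

/-- The partial function computed by a program when it is run with the oracle `g`. -/
def OracleCode.eval (g : ℕ →. ℕ) : OracleCode → ℕ →. ℕ
  | .zero => fun _ => Part.some 0
  | .succ => fun n => Part.some (n + 1)
  | .left => fun n => Part.some (Nat.unpair n).1
  | .right => fun n => Part.some (Nat.unpair n).2
  | .oracle => g
  | .pair cf ch => fun n => Nat.pair <$> OracleCode.eval g cf n <*> OracleCode.eval g ch n
  | .comp cf ch => fun n => OracleCode.eval g ch n >>= OracleCode.eval g cf
  | .prec cf ch => fun p =>
      (Nat.unpair p).2.rec (OracleCode.eval g cf (Nat.unpair p).1) fun y IH => do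
        let i ← IH
        OracleCode.eval g ch (Nat.pair (Nat.unpair p).1 (Nat.pair y i))
  | .rfind cf => fun a =>
      Nat.rfind fun n => (fun m => decide (m = 0)) <$> OracleCode.eval g cf (Nat.pair a n)

/-! ### Computable points and computable functions on the reals -/

/-- The standard numbering of the rational numbers: the number `⟨⟨a, b⟩, d⟩` denotes
`(a - b) / (d + 1)`. -/
def ratOfNat (m : ℕ) : ℚ :=
  (((Nat.unpair (Nat.unpair m).1).1 : ℚ) - ((Nat.unpair (Nat.unpair m).1).2 : ℚ)) /
    (((Nat.unpair m).2 : ℚ) + 1)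

/-- The function `φ : ℕ → ℚ` represents the real number `x` if `|x - φ n| ≤ 1 / 2 ^ n` for all
`n`. -/
def Represents (φ : ℕ → ℚ) (x : ℝ) : Prop :=
  ∀ n, |x - (φ n : ℝ)| ≤ 1 / 2 ^ n

/-- A real number is computable if it has a computable representation. -/
def IsComputableReal (x : ℝ) : Prop :=
  ∃ g : ℕ → ℕ, Computable g ∧ Represents (fun k => ratOfNat (g k)) x

/-- A sequence of functions `f n : ℝ → ℝ` is computable (uniformly in `n`): there is one oracle
machine that, fed with (number codes `g k` of the values of) any representation of any real `x`,
outputs on the input `⟨n, k⟩` a rational `y` with `|f n x - y| < 1 / 2 ^ k`. -/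
def IsComputableSeq (f : ℕ → ℝ → ℝ) : Prop :=
  ∃ c : OracleCode, ∀ (x : ℝ) (g : ℕ → ℕ), Represents (fun k => ratOfNat (g k)) x →
    ∀ n k : ℕ, ∃ m ∈ c.eval (g : ℕ →. ℕ) (Nat.pair n k), |f n x - (ratOfNat m : ℝ)| < 1 / 2 ^ k

/-! ### The second level of the arithmetical hierarchy -/

/-- `A` is a `Π⁰₂` set of natural numbers: `n ∈ A ↔ ∀ a, ∃ b, R n a b` for a decidable `R`. -/
def IsPi02 (A : Set ℕ) : Prop :=
  ∃ R : ℕ → ℕ → ℕ → Prop, ComputablePred (fun p : ℕ × ℕ × ℕ => R p.1 p.2.1 p.2.2) ∧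
    ∀ n, n ∈ A ↔ ∀ a, ∃ b, R n a b

/-- `A` is `Π⁰₂`-complete (with respect to many-one reductions). -/
def IsPi02Complete (A : Set ℕ) : Prop :=
  IsPi02 A ∧ ∀ B : Set ℕ, IsPi02 B → (fun n => n ∈ B) ≤₀ (fun n => n ∈ A)

/-! ### The one-dimensional game -/

/-- The position at time `t` of a player who starts at `z₀` and moves with velocity `w`. -/
noncomputable def position (z₀ : ℝ) (w : ℝ → ℝ) (t : ℝ) : ℝ :=
  z₀ + ∫ s in (0 : ℝ)..t, w s

/-- Evader, starting at `y₀` and playing `v`, is never caught by Pursuer, starting at `x₀` and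
playing `u`. -/
def EvaderWins (x₀ y₀ : ℝ) (u v : ℝ → ℝ) : Prop :=
  ∀ t : ℝ, 0 ≤ t → position x₀ u t ≠ position y₀ v t

end PursuitEvasion

/-!
Upper bound. Evader wins if and only if for every `N` the distance of the players is positive on
`[0, N]`, so it suffices that the latter is recursively enumerable. A machine that halts has used only
a finite part of its oracle (`OracleCode.eval_finite_use`), hence it can be run on finite initial
segments of names that are shared by all points of a dyadic interval, and its output is then valid on
the whole interval. By bisection, all these runs halt on a sufficiently fine grid of `[0, N]`
(`Computes.exists_forall_dom`). They provide step functions close to the velocities, thus a piecewise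
linear function close to the distance, which is positive if this function exceeds the error bound at
the nodes (`pos_of_pos_on_nodes`). By compactness, such a certificate is found whenever the distance
is positive (`exists_certificate_iff`).

Hardness. Let `n ∈ A ↔ ∀ a, ∃ b, R n a b` with decidable `R`. The real `2 ^ (-b)` for the least `b`
with `R n a b`, or `0` if there is none, is computable uniformly in `n` and `a` (`searchReal`). While
Pursuer rests, Evader in each time interval `[a, a + 1]` approaches up to the fraction of the initial
distance given by this real and returns. So Evader is caught if and only if one of the reals is `0`, that
is, if `n ∉ A` (`exists_strategies_of_isPi02`). The speed is a Lipschitz function that can be computed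
at rational points, hence a machine computes it with a single question to the oracle. A universal
`Π⁰₂` set as `A` makes the winning set complete, and a complete set is undecidable because the halting
problem reduces to it.
-/

namespace PursuitEvasion
open Encodable Denumerable Set
open Nat.Partrec (Code)

/-! ### Oracle programs -/

/-- The use principle: a halting computation asks the oracle finitely many questions, so any
oracle that answers like `g` below some bound `L` leads to the same output. -/
theorem OracleCode.eval_finite_use (g : ℕ →. ℕ) (c : OracleCode) :
    ∀ n m : ℕ, m ∈ c.eval g n → ∃ L : ℕ, ∀ g' : ℕ →. ℕ,
      (∀ k < L, ∀ b ∈ g k, b ∈ g' k) → m ∈ c.eval g' n := by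
  induction c with
  | zero => exact fun n m h => ⟨0, fun _ _ => h⟩
  | succ => exact fun n m h => ⟨0, fun _ _ => h⟩
  | left => exact fun n m h => ⟨0, fun _ _ => h⟩
  | right => exact fun n m h => ⟨0, fun _ _ => h⟩
  | oracle => exact fun n m h => ⟨n + 1, fun _ hg => hg n n.lt_succ_self m h⟩
  | pair cf ch ihf ihh =>
    intro n m h
    simp only [OracleCode.eval, Seq.seq, Part.map_eq_map, Part.mem_bind_iff, Part.mem_map_iff,
      exists_exists_and_eq_and] at h ⊢
    obtain ⟨a, ha, b, hb, rfl⟩ := h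
    obtain ⟨L₁, h₁⟩ := ihf n a ha
    obtain ⟨L₂, h₂⟩ := ihh n b hb
    exact ⟨max L₁ L₂, fun g' hg => ⟨a, h₁ g' fun k hk => hg k (lt_max_of_lt_left hk), b,
      h₂ g' fun k hk => hg k (lt_max_of_lt_right hk), rfl⟩⟩
  | comp cf ch ihf ihh =>
    intro n m h
    obtain ⟨a, ha, hm⟩ := Part.mem_bind_iff.1 h
    obtain ⟨L₁, h₁⟩ := ihh n a ha
    obtain ⟨L₂, h₂⟩ := ihf a m hm
    exact ⟨max L₁ L₂, fun g' hg => Part.mem_bind_iff.2 ⟨a,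
      h₁ g' fun k hk => hg k (lt_max_of_lt_left hk),
      h₂ g' fun k hk => hg k (lt_max_of_lt_right hk)⟩⟩
  | prec cf ch ihf ihh =>
    intro n
    simp only [OracleCode.eval]
    generalize (Nat.unpair n).1 = x
    generalize (Nat.unpair n).2 = y
    induction y with
    | zero => exact fun m h => ihf x m h
    | succ y ih =>
      intro m h
      simp only [Part.bind_eq_bind, Part.mem_bind_iff] at h ⊢
      obtain ⟨a, ha, hm⟩ := h
      obtain ⟨L₁, h₁⟩ := ih a ha
      obtain ⟨L₂, h₂⟩ := ihh _ m hm
      exact ⟨max L₁ L₂, fun g' hg => ⟨a, h₁ g' fun k hk => hg k (lt_max_of_lt_left hk),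
        h₂ g' fun k hk => hg k (lt_max_of_lt_right hk)⟩⟩
  | rfind cf ih =>
    intro n m h
    obtain ⟨h₀, hlt⟩ := Nat.mem_rfind.1 h
    obtain ⟨a, ha, ha'⟩ := (Part.mem_map_iff _).1 h₀
    obtain ⟨L₁, h₁⟩ := ih _ a ha
    have key : ∀ j, ∃ L, ∀ g' : ℕ →. ℕ, (∀ k < L, ∀ b ∈ g k, b ∈ g' k) → j < m →
        false ∈ (cf.eval g' (Nat.pair n j)).map fun a => decide (a = 0) := by
      intro j
      by_cases hj : j < m
      · obtain ⟨b, hb, hb'⟩ := (Part.mem_map_iff _).1 (hlt hj)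
        obtain ⟨L, hL⟩ := ih _ b hb
        exact ⟨L, fun g' hg _ => (Part.mem_map_iff _).2 ⟨b, hL g' hg, hb'⟩⟩
      · exact ⟨0, fun _ _ h => absurd h hj⟩
    choose L hL using key
    refine ⟨max L₁ ((Finset.range m).sup L), fun g' hg => Nat.mem_rfind.2
      ⟨(Part.mem_map_iff _).2 ⟨a, h₁ g' fun k hk => hg k (lt_max_of_lt_left hk), ha'⟩, fun {j} hj =>
        hL j g' (fun k hk => hg k (lt_max_of_lt_right (hk.trans_le ?_))) hj⟩⟩
    exact Finset.le_sup (f := L) (Finset.mem_range.2 hj)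

theorem OracleCode.eval_mono {g g' : ℕ →. ℕ} (h : ∀ k, ∀ b ∈ g k, b ∈ g' k) (c : OracleCode)
    {n m : ℕ} (hm : m ∈ c.eval g n) : m ∈ c.eval g' n :=
  let ⟨_, hL⟩ := c.eval_finite_use g n m hm
  hL g' fun k _ => h k

/-- Running a fixed program is partial recursive, uniformly in a partial recursive family of
oracles. -/
theorem OracleCode.eval_partrec {α : Type*} [Primcodable α] {G : α → ℕ →. ℕ} (hG : Partrec₂ G)
    (c : OracleCode) : Partrec₂ fun a n => c.eval (G a) n := by
  induction c with
  | zero => exact (Computable.const 0).partrec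
  | succ => exact (Computable.succ.comp Computable.snd).partrec
  | left => exact (Computable.fst.comp (Computable.unpair.comp Computable.snd)).partrec
  | right => exact (Computable.snd.comp (Computable.unpair.comp Computable.snd)).partrec
  | oracle => exact hG
  | pair cf ch ihf ihh =>
    have : Partrec fun p : α × ℕ => (cf.eval (G p.1) p.2).bind fun a =>
        (ch.eval (G p.1) p.2).map fun b => Nat.pair a b :=
      Partrec.bind ihf (Partrec.map (Partrec.comp ihh Computable.fst)
        (Primrec₂.natPair.to_comp.comp (Computable.snd.comp Computable.fst) Computable.snd).to₂).to₂
    refine this.of_eq fun p => ?_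
    simp [OracleCode.eval, Seq.seq, Part.bind_map]
  | comp cf ch ihf ihh =>
    exact Partrec.bind ihh
      (Partrec.comp ihf ((Computable.fst.comp Computable.fst).pair Computable.snd)).to₂
  | prec cf ch ihf ihh =>
    have h1 : Computable fun p : α × ℕ => (Nat.unpair p.2).1 :=
      Computable.fst.comp (Computable.unpair.comp Computable.snd)
    have h2 : Computable fun p : α × ℕ => (Nat.unpair p.2).2 :=
      Computable.snd.comp (Computable.unpair.comp Computable.snd)
    refine (Partrec.nat_rec h2 (Partrec.comp ihf (Computable.fst.pair h1))
      (h := fun p q => ch.eval (G p.1) (Nat.pair (Nat.unpair p.2).1 (Nat.pair q.1 q.2))) ?_)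
    refine (Partrec.comp ihh ((Computable.fst.comp Computable.fst).pair
      (Primrec₂.natPair.to_comp.comp (h1.comp Computable.fst)
        (Primrec₂.natPair.to_comp.comp (Computable.fst.comp Computable.snd)
          (Computable.snd.comp Computable.snd))))).to₂
  | rfind cf ih =>
    refine Partrec.rfind (p := fun (p : α × ℕ) n => (fun m => decide (m = 0)) <$>
      cf.eval (G p.1) (Nat.pair p.2 n)) ?_
    refine Partrec.map (f := fun q : (α × ℕ) × ℕ => cf.eval (G q.1.1) (Nat.pair q.1.2 q.2))
      (Partrec.comp ih ((Computable.fst.comp Computable.fst).pair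
        (Primrec₂.natPair.to_comp.comp (Computable.snd.comp Computable.fst) Computable.snd)))
      (g := fun _ m => decide (m = 0)) ?_
    exact ((Primrec.eq (α := ℕ)).decide.comp Primrec.snd (Primrec.const 0)).to_comp.to₂

/-- Oracle programs can carry out every ordinary computation. -/
theorem OracleCode.exists_of_partrec {f : ℕ →. ℕ} (hf : Nat.Partrec f) :
    ∃ c : OracleCode, ∀ g : ℕ →. ℕ, c.eval g = f := by
  induction hf with
  | zero => exact ⟨.zero, fun _ => rfl⟩
  | succ => exact ⟨.succ, fun _ => rfl⟩
  | left => exact ⟨.left, fun _ => rfl⟩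
  | right => exact ⟨.right, fun _ => rfl⟩
  | pair _ _ ihf ihh =>
    obtain ⟨cf, hf⟩ := ihf
    obtain ⟨ch, hh⟩ := ihh
    exact ⟨.pair cf ch, fun g => by simp only [OracleCode.eval, hf, hh]; rfl⟩
  | comp _ _ ihf ihh =>
    obtain ⟨cf, hf⟩ := ihf
    obtain ⟨ch, hh⟩ := ihh
    exact ⟨.comp cf ch, fun g => by simp only [OracleCode.eval, hf, hh]; rfl⟩
  | prec _ _ ihf ihh =>
    obtain ⟨cf, hf⟩ := ihf
    obtain ⟨ch, hh⟩ := ihh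
    exact ⟨.prec cf ch, fun g => by simp only [OracleCode.eval, hf, hh]; rfl⟩
  | rfind _ ih =>
    obtain ⟨cf, hf⟩ := ih
    exact ⟨.rfind cf, fun g => by simp only [OracleCode.eval, hf]; rfl⟩

/-! ### Stages of recursively enumerable predicates -/

/-- Kleene's normal form: a recursively enumerable predicate is the increasing union of uniformly
primitive recursive stages. Stages, unlike the predicate, can be checked for all members of a finite
set at once. -/
theorem exists_primrec_stages_of_rePred {α : Type*} [Primcodable α] {p : α → Prop} (hp : REPred p) :
    ∃ D : α → ℕ → Prop, PrimrecRel D ∧ (∀ a s t, s ≤ t → D a s → D a t) ∧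
      ∀ a, p a ↔ ∃ s, D a s := by
  obtain ⟨c, hc⟩ := Nat.Partrec.Code.exists_code.1 hp
  refine ⟨fun a s => (Nat.Partrec.Code.evaln s c (encode a)).isSome, ?_, ?_, ?_⟩
  · refine PrimrecPred.of_eq (Primrec.primrecPred (p := fun a : α × ℕ =>
      (Nat.Partrec.Code.evaln a.2 c (encode a.1)).isSome) ?_) fun _ => Iff.rfl
    simp only [Bool.decide_eq_true]
    exact Primrec.option_isSome.comp (Nat.Partrec.Code.primrec_evaln.comp
      ((Primrec.snd.pair (Primrec.const c)).pair (Primrec.encode.comp Primrec.fst)))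
  · intro a s t hst h
    obtain ⟨x, hx⟩ := Option.isSome_iff_exists.1 h
    exact Option.isSome_iff_exists.2 ⟨x, Nat.Partrec.Code.evaln_mono hst hx⟩
  · intro a
    have h1 : p a ↔ (Nat.Partrec.Code.eval c (encode a)).Dom := by
      rw [hc]; simp [Part.assert]
    rw [h1, Part.dom_iff_mem]
    simp only [Nat.Partrec.Code.evaln_complete, Option.isSome_iff_exists]
    exact exists_comm

/-! ### Arithmetic on the codes of rational numbers -/

theorem primrec_two_pow : Primrec fun k : ℕ => 2 ^ k :=
  (Primrec₂.unpaired'.1 Nat.Primrec.pow).comp (Primrec.const 2) Primrec.id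

/-- The code of the rational number `(a - b) / (d + 1)`. -/
def ratCode (a b d : ℕ) : ℕ := Nat.pair (Nat.pair a b) d

theorem ratOfNat_ratCode (a b d : ℕ) : ratOfNat (ratCode a b d) = ((a : ℚ) - b) / (d + 1) := by
  simp [ratOfNat, ratCode]

theorem primrec_ratCode {α : Type*} [Primcodable α] {a b d : α → ℕ} (ha : Primrec a)
    (hb : Primrec b) (hd : Primrec d) : Primrec fun x => ratCode (a x) (b x) (d x) :=
  Primrec₂.natPair.comp (Primrec₂.natPair.comp ha hb) hd

/-- The number `a` in the code of `(a - b) / (d + 1)`. -/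
def codePos (m : ℕ) : ℕ := m.unpair.1.unpair.1

/-- The number `b` in the code of `(a - b) / (d + 1)`. -/
def codeNeg (m : ℕ) : ℕ := m.unpair.1.unpair.2

/-- The number `d` in the code of `(a - b) / (d + 1)`; the denominator is `d + 1`. -/
def codeDen (m : ℕ) : ℕ := m.unpair.2

theorem primrec_codePos : Primrec codePos :=
  Primrec.fst.comp (Primrec.unpair.comp (Primrec.fst.comp Primrec.unpair))

theorem primrec_codeNeg : Primrec codeNeg :=
  Primrec.snd.comp (Primrec.unpair.comp (Primrec.fst.comp Primrec.unpair))

theorem primrec_codeDen : Primrec codeDen := Primrec.snd.comp Primrec.unpair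

theorem ratOfNat_eq (m : ℕ) : ratOfNat m = ((codePos m : ℚ) - codeNeg m) / (codeDen m + 1) := rfl

/-- A code of `-q`, from a code of `q`. -/
def codeNegate (m : ℕ) : ℕ := ratCode (codeNeg m) (codePos m) (codeDen m)

/-- A code of `q + q'`, from codes of `q` and `q'`. The last component is
`(d + 1) * (d' + 1) - 1`, written without subtraction. -/
def codeAdd (m m' : ℕ) : ℕ :=
  ratCode (codePos m * (codeDen m' + 1) + codePos m' * (codeDen m + 1))
    (codeNeg m * (codeDen m' + 1) + codeNeg m' * (codeDen m + 1))
    (codeDen m * codeDen m' + codeDen m + codeDen m')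

/-- A code of `q * q'`, from codes of `q` and `q'`. -/
def codeMul (m m' : ℕ) : ℕ :=
  ratCode (codePos m * codePos m' + codeNeg m * codeNeg m')
    (codePos m * codeNeg m' + codeNeg m * codePos m')
    (codeDen m * codeDen m' + codeDen m + codeDen m')

/-- The code of `a / 2 ^ k`. -/
def dyadicCode (a k : ℕ) : ℕ := ratCode a 0 (2 ^ k - 1)

/-- The order of the rationals on codes, by cross-multiplication in `ℕ`. -/
def CodeLT (m m' : ℕ) : Prop :=
  codePos m * (codeDen m' + 1) + codeNeg m' * (codeDen m + 1) <
    codePos m' * (codeDen m + 1) + codeNeg m * (codeDen m' + 1)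

theorem ratOfNat_codeNegate (m : ℕ) : ratOfNat (codeNegate m) = -ratOfNat m := by
  rw [codeNegate, ratOfNat_ratCode, ratOfNat_eq]; ring

theorem ratOfNat_codeAdd (m m' : ℕ) :
    ratOfNat (codeAdd m m') = ratOfNat m + ratOfNat m' := by
  rw [codeAdd, ratOfNat_ratCode, ratOfNat_eq, ratOfNat_eq, div_add_div _ _ (by positivity)
    (by positivity)]
  push_cast
  congr 1 <;> ring

theorem ratOfNat_codeMul (m m' : ℕ) :
    ratOfNat (codeMul m m') = ratOfNat m * ratOfNat m' := by
  rw [codeMul, ratOfNat_ratCode, ratOfNat_eq, ratOfNat_eq, div_mul_div_comm]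
  push_cast
  congr 1 <;> ring

theorem ratOfNat_dyadicCode (a k : ℕ) : ratOfNat (dyadicCode a k) = a / 2 ^ k := by
  rw [dyadicCode, ratOfNat_ratCode, Nat.cast_sub Nat.one_le_two_pow]
  simp

theorem codeLT_iff (m m' : ℕ) : CodeLT m m' ↔ ratOfNat m < ratOfNat m' := by
  rw [ratOfNat_eq, ratOfNat_eq, div_lt_div_iff₀ (by positivity) (by positivity), CodeLT,
    ← Nat.cast_lt (α := ℚ)]
  push_cast
  constructor <;> intro h <;> linarith

theorem primrec_codeNegate : Primrec codeNegate :=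
  primrec_ratCode primrec_codeNeg primrec_codePos primrec_codeDen

theorem primrec_mul_fst_snd {f g : ℕ → ℕ} (hf : Primrec f) (hg : Primrec g) :
    Primrec fun p : ℕ × ℕ => f p.1 * g p.2 :=
  Primrec.nat_mul.comp (hf.comp Primrec.fst) (hg.comp Primrec.snd)

theorem primrec_mul_snd_fst {f g : ℕ → ℕ} (hf : Primrec f) (hg : Primrec g) :
    Primrec fun p : ℕ × ℕ => f p.2 * g p.1 :=
  Primrec.nat_mul.comp (hf.comp Primrec.snd) (hg.comp Primrec.fst)

theorem primrec_codeDen_succ : Primrec fun m => codeDen m + 1 :=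
  Primrec.succ.comp primrec_codeDen

theorem primrec_codeDen_prod :
    Primrec fun p : ℕ × ℕ => codeDen p.1 * codeDen p.2 + codeDen p.1 + codeDen p.2 :=
  Primrec.nat_add.comp (Primrec.nat_add.comp (primrec_mul_fst_snd primrec_codeDen primrec_codeDen)
    (primrec_codeDen.comp Primrec.fst)) (primrec_codeDen.comp Primrec.snd)

theorem primrec_codeAdd : Primrec₂ codeAdd :=
  primrec_ratCode
    (Primrec.nat_add.comp (primrec_mul_fst_snd primrec_codePos primrec_codeDen_succ)
      (primrec_mul_snd_fst primrec_codePos primrec_codeDen_succ))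
    (Primrec.nat_add.comp (primrec_mul_fst_snd primrec_codeNeg primrec_codeDen_succ)
      (primrec_mul_snd_fst primrec_codeNeg primrec_codeDen_succ))
    primrec_codeDen_prod

theorem primrec_codeMul : Primrec₂ codeMul :=
  primrec_ratCode
    (Primrec.nat_add.comp (primrec_mul_fst_snd primrec_codePos primrec_codePos)
      (primrec_mul_fst_snd primrec_codeNeg primrec_codeNeg))
    (Primrec.nat_add.comp (primrec_mul_fst_snd primrec_codePos primrec_codeNeg)
      (primrec_mul_fst_snd primrec_codeNeg primrec_codePos))
    primrec_codeDen_prod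

theorem primrec_dyadicCode : Primrec₂ dyadicCode :=
  primrec_ratCode Primrec.fst (Primrec.const 0)
    (Primrec.nat_sub.comp (primrec_two_pow.comp Primrec.snd) (Primrec.const 1))

theorem primrecRel_codeLT : PrimrecRel CodeLT :=
  Primrec.nat_lt.comp
    (Primrec.nat_add.comp (primrec_mul_fst_snd primrec_codePos primrec_codeDen_succ)
      (primrec_mul_snd_fst primrec_codeNeg primrec_codeDen_succ))
    (Primrec.nat_add.comp (primrec_mul_snd_fst primrec_codePos primrec_codeDen_succ)
      (primrec_mul_fst_snd primrec_codeNeg primrec_codeDen_succ))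

/-! ### Names of reals -/

theorem ratOfNat_surjective : Function.Surjective ratOfNat := by
  intro q
  refine ⟨ratCode q.num.toNat (-q.num).toNat (q.den - 1), ?_⟩
  rw [ratOfNat_ratCode]
  have h : ((q.num.toNat : ℚ) - (-q.num).toNat) = q.num := by
    have := Int.toNat_sub_toNat_neg q.num
    exact_mod_cast congrArg (Int.cast (R := ℚ)) this
  rw [h, Nat.cast_sub q.den_pos, Nat.cast_one, sub_add_cancel, Rat.num_div_den]

/-- Names of twice the required precision, which are stable under small changes of the real. -/
theorem exists_precise_name (x : ℝ) :
    ∃ g : ℕ → ℕ, ∀ k, |x - (ratOfNat (g k) : ℝ)| ≤ 1 / 2 ^ (k + 1) := by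
  have (k : ℕ) : ∃ m, |x - (ratOfNat m : ℝ)| ≤ 1 / 2 ^ (k + 1) := by
    obtain ⟨q, hq⟩ := exists_rat_near x (ε := 1 / 2 ^ (k + 1)) (by positivity)
    obtain ⟨m, rfl⟩ := ratOfNat_surjective q
    exact ⟨m, hq.le⟩
  choose g hg using this
  exact ⟨g, hg⟩

theorem exists_name (x : ℝ) : ∃ g : ℕ → ℕ, Represents (fun k => ratOfNat (g k)) x := by
  obtain ⟨g, hg⟩ := exists_precise_name x
  exact ⟨g, fun k => (hg k).trans
    (one_div_le_one_div_of_le (by positivity) (pow_le_pow_right₀ one_le_two k.le_succ))⟩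

/-! ### Continuity of computable functions -/

/-- The program `c` computes the sequence `f`, in the sense of `IsComputableSeq`. -/
def Computes (c : OracleCode) (f : ℕ → ℝ → ℝ) : Prop :=
  ∀ (x : ℝ) (g : ℕ → ℕ), Represents (fun k => ratOfNat (g k)) x →
    ∀ n k : ℕ, ∃ m ∈ c.eval (g : ℕ →. ℕ) (Nat.pair n k), |f n x - (ratOfNat m : ℝ)| < 1 / 2 ^ k

/-- The machine reads only finitely much of a name, and every real close enough to `x` has a name
that begins like a precise name of `x`. -/
theorem Computes.continuous {c : OracleCode} {f : ℕ → ℝ → ℝ} (hc : Computes c f) (n : ℕ) :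
    Continuous (f n) := by
  refine Metric.continuous_iff.2 fun x ε hε => ?_
  obtain ⟨k, hk⟩ := exists_pow_lt_of_lt_one (half_pos hε) (one_half_lt_one (α := ℝ))
  obtain ⟨g, hg⟩ := exists_precise_name x
  have hgx : Represents (fun k => ratOfNat (g k)) x := fun k => (hg k).trans
    (one_div_le_one_div_of_le (by positivity) (pow_le_pow_right₀ one_le_two k.le_succ))
  obtain ⟨m, hm, hmx⟩ := hc x g hgx n k
  obtain ⟨L, hL⟩ := c.eval_finite_use _ _ _ hm
  refine ⟨1 / 2 ^ (L + 1), by positivity, fun y hy => ?_⟩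
  obtain ⟨g', hg'⟩ := exists_name y
  have hgy : Represents (fun k => ratOfNat ((fun i => if i < L then g i else g' i) k)) y := by
    intro i
    by_cases hi : i < L
    · simp only [hi, if_true]
      have h1 : |y - x| ≤ 1 / 2 ^ (i + 1) := (Real.dist_eq y x ▸ hy).le.trans
        (one_div_le_one_div_of_le (by positivity) (pow_le_pow_right₀ one_le_two (by lia)))
      calc |y - (ratOfNat (g i) : ℝ)| ≤ |y - x| + |x - ratOfNat (g i)| := abs_sub_le _ _ _
        _ ≤ 1 / 2 ^ (i + 1) + 1 / 2 ^ (i + 1) := add_le_add h1 (hg i)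
        _ = 1 / 2 ^ i := by rw [pow_succ]; field_simp; norm_num
    · simp only [hi, if_false]
      exact hg' i
  obtain ⟨m', hm', hmy⟩ := hc y _ hgy n k
  have hmm : m = m' := Part.mem_unique (hL _ fun i hi b hb => by
    simp only [PFun.coe_val, Part.mem_some_iff] at hb ⊢
    rw [if_pos hi, hb]) hm'
  subst hmm
  rw [Real.dist_eq]
  have hk' : (1 : ℝ) / 2 ^ k < ε / 2 := by simpa using hk
  have := abs_sub_le (f n y) (ratOfNat m) (f n x)
  rw [abs_sub_comm (ratOfNat m : ℝ)] at this
  linarith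

/-! ### Machines on dyadic intervals -/

/-- The first `L + 1` entries `⌊j / 2 ^ (L - k)⌋ / 2 ^ k`, `k ≤ L`, of a name that is shared by
all points of the interval `[j / 2 ^ L, (j + 1) / 2 ^ L]`. Later questions remain unanswered, so a
machine that asks them does not halt. -/
def dyadicOracle (j L : ℕ) : ℕ →. ℕ := fun k =>
  ((if k ≤ L then some (dyadicCode (j / 2 ^ (L - k)) k) else none : Option ℕ) : Part ℕ)

theorem mem_dyadicOracle {j L k b : ℕ} :
    b ∈ dyadicOracle j L k ↔ k ≤ L ∧ b = dyadicCode (j / 2 ^ (L - k)) k := by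
  by_cases h : k ≤ L <;> simp [dyadicOracle, h]

theorem partrec_dyadicOracle : Partrec₂ fun p : ℕ × ℕ => dyadicOracle p.1 p.2 := by
  refine Computable.ofOption (Primrec.to_comp (α := (ℕ × ℕ) × ℕ) (Primrec.ite
    (Primrec.nat_le.comp Primrec.snd (Primrec.snd.comp Primrec.fst)) ?_ (Primrec.const none)))
  exact Primrec.option_some.comp (primrec_dyadicCode.comp (Primrec.nat_div.comp
    (Primrec.fst.comp Primrec.fst) (primrec_two_pow.comp
      (Primrec.nat_sub.comp (Primrec.snd.comp Primrec.fst) Primrec.snd))) Primrec.snd)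

theorem abs_sub_dyadic_le {j L k : ℕ} (hk : k ≤ L) {x : ℝ}
    (hx : x ∈ Icc ((j : ℝ) / 2 ^ L) ((j + 1 : ℝ) / 2 ^ L)) :
    |x - ((ratOfNat (dyadicCode (j / 2 ^ (L - k)) k) : ℚ) : ℝ)| ≤ 1 / 2 ^ k := by
  rw [ratOfNat_dyadicCode]
  have h1 : j / 2 ^ (L - k) * 2 ^ (L - k) ≤ j := Nat.div_mul_le_self _ _
  have h2 : j + 1 ≤ (j / 2 ^ (L - k) + 1) * 2 ^ (L - k) :=
    mul_comm _ (2 ^ (L - k)) ▸ Nat.lt_mul_div_succ j (by positivity)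
  generalize j / 2 ^ (L - k) = a at h1 h2 ⊢
  have h1' : (a * 2 ^ (L - k) : ℝ) ≤ j := by exact_mod_cast h1
  have h2' : (j + 1 : ℝ) ≤ (a + 1) * 2 ^ (L - k) := by exact_mod_cast h2
  have hL : (2 : ℝ) ^ L = 2 ^ (L - k) * 2 ^ k := by rw [← pow_add, Nat.sub_add_cancel hk]
  have h3 : (a : ℝ) / 2 ^ k ≤ j / 2 ^ L := by
    rw [hL, div_le_div_iff₀ (by positivity) (by positivity), ← mul_assoc]
    gcongr
  have h4 : (j + 1 : ℝ) / 2 ^ L ≤ (a + 1) / 2 ^ k := by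
    rw [hL, div_le_div_iff₀ (by positivity) (by positivity), ← mul_assoc]
    gcongr
  push_cast
  rw [add_div (a : ℝ)] at h4
  rw [abs_le]
  constructor
  · have : (0 : ℝ) ≤ 1 / 2 ^ k := by positivity
    linarith [hx.1]
  · linarith [hx.2, hx.1]

/-- A machine that halts on the name common to a dyadic interval approximates the function on the
whole interval. -/
theorem Computes.abs_sub_lt {c : OracleCode} {f : ℕ → ℝ → ℝ} (hc : Computes c f)
    {n k j L m : ℕ} (hm : m ∈ c.eval (dyadicOracle j L) (Nat.pair n k)) {x : ℝ}
    (hx : x ∈ Icc ((j : ℝ) / 2 ^ L) ((j + 1 : ℝ) / 2 ^ L)) :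
    |f n x - (ratOfNat m : ℝ)| < 1 / 2 ^ k := by
  obtain ⟨g, hg⟩ := exists_name x
  have hgx : Represents (fun k => ratOfNat
      ((fun i => if i ≤ L then dyadicCode (j / 2 ^ (L - i)) i else g i) k)) x := by
    intro i
    by_cases hi : i ≤ L
    · simp only [hi, if_true]
      exact abs_sub_dyadic_le hi hx
    · simp only [hi, if_false]
      exact hg i
  obtain ⟨m', hm', hmx⟩ := hc x _ hgx n k
  have hmm : m = m' := Part.mem_unique (c.eval_mono (fun i b hb => by
    obtain ⟨hi, rfl⟩ := mem_dyadicOracle.1 hb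
    simp [hi]) hm) hm'
  exact hmm ▸ hmx

/-- A path in the binary tree of dyadic intervals shrinks to a point. -/
theorem exists_nested_point {p : ℕ → ℕ} (hp : ∀ L, p (L + 1) / 2 = p L) :
    ∃ x : ℝ, ∀ L, x ∈ Icc ((p L : ℝ) / 2 ^ L) ((p L + 1 : ℝ) / 2 ^ L) := by
  have hmono : Monotone fun L => (p L : ℝ) / 2 ^ L := by
    refine monotone_nat_of_le_succ fun L => ?_
    have h : (p L * 2 : ℝ) ≤ p (L + 1) := by exact_mod_cast (show p L * 2 ≤ p (L + 1) by grind)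
    rw [pow_succ, div_le_div_iff₀ (by positivity) (by positivity)]
    nlinarith [pow_pos (zero_lt_two (α := ℝ)) L]
  have hanti : Antitone fun L => (p L + 1 : ℝ) / 2 ^ L := by
    refine antitone_nat_of_succ_le fun L => ?_
    have h : (p (L + 1) + 1 : ℝ) ≤ (p L + 1) * 2 := by
      exact_mod_cast (show p (L + 1) + 1 ≤ (p L + 1) * 2 by grind)
    rw [pow_succ, div_le_div_iff₀ (by positivity) (by positivity)]
    nlinarith [pow_pos (zero_lt_two (α := ℝ)) L]
  have hle : (fun L => (p L : ℝ) / 2 ^ L) ≤ fun L => (p L + 1 : ℝ) / 2 ^ L := fun L => by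
    dsimp only; gcongr; linarith
  exact ⟨_, fun L => Set.mem_iInter.1 (hmono.ciSup_mem_iInter_Icc_of_antitone hanti hle) L⟩

/-- All machines on the dyadic intervals of `[0, N]` halt once the grid is fine enough. Otherwise, by
bisection, there is an infinite path of intervals that always have subintervals where the machine
fails. The path yields a name of its limit point, and on it the machine would not halt. -/
theorem Computes.exists_forall_dom {c : OracleCode} {f : ℕ → ℝ → ℝ} (hc : Computes c f)
    (n k N : ℕ) : ∃ L₀, ∀ L ≥ L₀, ∀ j < N * 2 ^ L,
      (c.eval (dyadicOracle j L) (Nat.pair n k)).Dom := by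
  let good (j L : ℕ) : Prop := ∃ M, ∀ L' ≥ L + M, ∀ j', j' / 2 ^ (L' - L) = j →
    (c.eval (dyadicOracle j' L') (Nat.pair n k)).Dom
  -- A bad interval has a bad half.
  have split (j L : ℕ) (hj : ¬ good j L) : ∃ j', j' / 2 = j ∧ ¬ good j' (L + 1) := by
    by_contra! h
    obtain ⟨M₀, h₀⟩ := h (2 * j) (by lia)
    obtain ⟨M₁, h₁⟩ := h (2 * j + 1) (by lia)
    refine hj ⟨max M₀ M₁ + 1, fun L' hL' j' hj' => ?_⟩
    have hLL : L' - L = (L' - (L + 1)) + 1 := by lia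
    rw [hLL, pow_succ, ← Nat.div_div_eq_div_mul] at hj'
    rcases (by lia : j' / 2 ^ (L' - (L + 1)) = 2 * j ∨ j' / 2 ^ (L' - (L + 1)) = 2 * j + 1)
      with h' | h'
    · exact h₀ L' (by lia) j' h'
    · exact h₁ L' (by lia) j' h'
  have root (j : ℕ) : good j 0 := by
    by_contra hj
    choose! s hs₁ hs₂ using split
    let p : ℕ → ℕ := fun L => Nat.rec j (fun L a => s a L) L
    have hbad : ∀ L, ¬ good (p L) L := by
      intro L
      induction L with
      | zero => exact hj
      | succ L ih => exact hs₂ _ _ ih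
    have hp : ∀ L, p (L + 1) / 2 = p L := fun L => hs₁ _ _ (hbad L)
    -- The path of bad intervals is coherent, so it is a name of the limit point.
    have hpre : ∀ d i, p (i + d) / 2 ^ d = p i := by
      intro d
      induction d with
      | zero => simp
      | succ d ih =>
        intro i
        rw [pow_succ', ← Nat.div_div_eq_div_mul, ← add_assoc, hp, ih]
    obtain ⟨x, hx⟩ := exists_nested_point hp
    have hname : Represents (fun i => ratOfNat ((fun i => dyadicCode (p i) i) i)) x := by
      intro i
      simpa using abs_sub_dyadic_le le_rfl (hx i)
    obtain ⟨m, hm, -⟩ := hc x _ hname n k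
    obtain ⟨L, hL⟩ := c.eval_finite_use _ _ _ hm
    refine hbad L ⟨0, fun L' hL' j' hj' => Part.dom_iff_mem.2 ⟨m, hL _ fun i hi b hb => ?_⟩⟩
    simp only [PFun.coe_val, Part.mem_some_iff] at hb
    have h1 : L' - i = (L' - L) + (L - i) := by lia
    rw [mem_dyadicOracle, hb, h1, pow_add, ← Nat.div_div_eq_div_mul, hj',
      ← hpre (L - i) i, Nat.add_sub_cancel' hi.le]
    exact ⟨by lia, rfl⟩
  choose M hM using root
  refine ⟨(Finset.range N).sup M, fun L hL j hj => ?_⟩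
  have hj' : j / 2 ^ L < N := Nat.div_lt_of_lt_mul (by rwa [mul_comm])
  refine hM (j / 2 ^ L) L ?_ j rfl
  have := Finset.le_sup (f := M) (Finset.mem_range.2 hj')
  lia

/-! ### Integrals of functions that are close to step functions -/

theorem abs_integral_sub_const_le {w : ℝ → ℝ} (hw : Continuous w) {a t c ε : ℝ} (hat : a ≤ t)
    (H : ∀ s ∈ Icc a t, |w s - c| ≤ ε) : |(∫ s in a..t, w s) - (t - a) * c| ≤ ε * (t - a) := by
  have h := intervalIntegral.norm_integral_le_of_norm_le_const (a := a) (b := t)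
    (f := fun s => w s - c) (C := ε) fun s hs => by
      rw [uIoc_of_le hat] at hs
      exact H s (Ioc_subset_Icc_self hs)
  rw [intervalIntegral.integral_sub (hw.intervalIntegrable _ _)
    (continuous_const.intervalIntegrable _ _), intervalIntegral.integral_const,
    abs_of_nonneg (sub_nonneg.2 hat)] at h
  simpa using h

/-- If a velocity is within `ε` of a step function, then its integral up to a node of the grid is
within `ε` times the elapsed time of the sum. -/
theorem abs_integral_sub_sum_le {w : ℝ → ℝ} (hw : Continuous w) {h ε : ℝ} (hh : 0 ≤ h) {c : ℕ → ℝ}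
    {M : ℕ} (H : ∀ j < M, ∀ s ∈ Icc (j * h) ((j + 1) * h), |w s - c j| ≤ ε) :
    ∀ i ≤ M, |(∫ s in 0..i * h, w s) - h * ∑ j ∈ Finset.range i, c j| ≤ ε * (i * h) := by
  intro i
  induction i with
  | zero => simp
  | succ i ih =>
    intro hi
    have h1 := ih (by lia)
    have h2 := abs_integral_sub_const_le hw (a := i * h) (t := (i + 1) * h) (by nlinarith)
      (H i (by lia))
    have h3 := intervalIntegral.integral_add_adjacent_intervals
      (hw.intervalIntegrable (μ := MeasureTheory.volume) 0 (i * h))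
      (hw.intervalIntegrable (i * h) ((i + 1) * h))
    rw [Finset.sum_range_succ]
    push_cast
    rw [← h3]
    refine (le_of_eq (congrArg _ ?_)).trans ((abs_add_le _ _).trans
      ((add_le_add h1 h2).trans (le_of_eq ?_))) <;> ring

/-- If the piecewise linear approximation of a moving distance exceeds the maximal error at all nodes
of the grid, then the distance stays positive between the nodes too. -/
theorem pos_of_pos_on_nodes {w : ℝ → ℝ} (hw : Continuous w) {h ε d : ℝ} (hh : 0 < h) (hε : 0 ≤ ε)
    {c : ℕ → ℝ} {M : ℕ} (H : ∀ j < M, ∀ s ∈ Icc (j * h) ((j + 1) * h), |w s - c j| ≤ ε)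
    (hnode : ∀ i ≤ M, ε * (M * h) < d + h * ∑ j ∈ Finset.range i, c j) :
    ∀ t ∈ Icc 0 (M * h), 0 < d + ∫ s in 0..t, w s := by
  suffices ∀ i ≤ M, ∀ t ∈ Icc 0 (i * h), 0 < d + ∫ s in 0..t, w s from this M le_rfl
  intro i
  induction i with
  | zero =>
    intro _ t ht
    have ht0 : t = 0 := le_antisymm (by simpa using ht.2) ht.1
    have := hnode 0 (Nat.zero_le _)
    have h0 : 0 ≤ ε * (M * h) := by positivity
    simp only [Finset.range_zero, Finset.sum_empty, mul_zero, add_zero] at this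
    simpa [ht0] using h0.trans_lt this
  | succ i ih =>
    intro hi t ht
    rcases le_total t (i * h) with hti | hti
    · exact ih (by lia) t ⟨ht.1, hti⟩
    have ht2 : t ≤ (i + 1) * h := by simpa using ht.2
    have h1 := abs_integral_sub_sum_le hw hh.le H i (by lia)
    have h2 := abs_integral_sub_const_le hw hti
      fun s hs => H i (by lia) s ⟨hs.1, hs.2.trans ht2⟩
    have h3 := intervalIntegral.integral_add_adjacent_intervals
      (hw.intervalIntegrable (μ := MeasureTheory.volume) 0 (i * h))
      (hw.intervalIntegrable (i * h) t)
    have h4 := hnode i (by lia)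
    have h5 := hnode (i + 1) hi
    rw [Finset.sum_range_succ] at h5
    rw [← h3]
    generalize (∑ j ∈ Finset.range i, c j) = S at *
    have hM : t ≤ M * h := ht2.trans (mul_le_mul_of_nonneg_right (by exact_mod_cast hi) hh.le)
    have hεt : ε * t ≤ ε * (M * h) := mul_le_mul_of_nonneg_left hM hε
    -- A linear function is, between two nodes, at least its minimum at the nodes.
    have h6 : ε * (M * h) < d + h * S + (t - i * h) * c i := by
      rcases le_total 0 (c i) with hc | hc
      · nlinarith
      · nlinarith
    rw [abs_le] at h1 h2
    nlinarith [h1.1, h2.1]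

/-! ### Partial sums of differences of machine outputs -/

theorem rePred_exists_mem_of_partrec {α β : Type*} [Primcodable α] [Primcodable β] {f : α →. β}
    (hf : Partrec f) {p : α → β → Prop} (hp : PrimrecRel p) :
    REPred fun a => ∃ b ∈ f a, p a b := by
  have hp' : Partrec₂ fun a b => Part.assert (p a b) fun _ => Part.some () :=
    hp.computablePred.to_re
  refine (hf.bind hp').dom_re.of_eq fun a => ?_
  simp [Part.assert, Part.mem_eq]

/-- A code of `s + (m - m') / 2 ^ L`, on codes. -/
def stepCode (L s m m' : ℕ) : ℕ :=
  codeAdd s (codeMul (codeAdd m (codeNegate m')) (dyadicCode 1 L))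

/-- A code of `d + ∑ j < i, (P j - Q j) / 2 ^ L`, where the summands are given by codes. It is
defined only if all summands are. -/
def partialSum (d L : ℕ) (P Q : ℕ →. ℕ) (i : ℕ) : Part ℕ :=
  Nat.rec (Part.some d)
    (fun j S => S.bind fun s => (P j).bind fun m => (Q j).map fun m' => stepCode L s m m') i

theorem exists_mem_partialSum {d L : ℕ} {P Q : ℕ →. ℕ} {p q : ℕ → ℕ} : ∀ {i : ℕ},
    (∀ j < i, p j ∈ P j ∧ q j ∈ Q j) → ∃ s ∈ partialSum d L P Q i, ratOfNat s =
      ratOfNat d + 1 / 2 ^ L * ∑ j ∈ Finset.range i, (ratOfNat (p j) - ratOfNat (q j))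
  | 0, _ => ⟨d, Part.mem_some d, by simp⟩
  | i + 1, h => by
    obtain ⟨s, hs, hs'⟩ := exists_mem_partialSum (d := d) (L := L) (i := i) fun j hj => h j (by lia)
    obtain ⟨hp, hq⟩ := h i i.lt_succ_self
    refine ⟨stepCode L s (p i) (q i), Part.mem_bind hs (Part.mem_bind hp (Part.mem_map _ hq)), ?_⟩
    rw [stepCode, ratOfNat_codeAdd, ratOfNat_codeMul, ratOfNat_codeAdd, ratOfNat_codeNegate,
      ratOfNat_dyadicCode, hs', Finset.sum_range_succ]
    push_cast
    ring

theorem dom_of_partialSum_dom {d L : ℕ} {P Q : ℕ →. ℕ} : ∀ {i : ℕ},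
    (partialSum d L P Q i).Dom → ∀ j < i, (P j).Dom ∧ (Q j).Dom
  | 0, _ => by simp
  | i + 1, h => by
    obtain ⟨s, hs⟩ := Part.dom_iff_mem.1 h
    obtain ⟨r, hr, hs⟩ := Part.mem_bind_iff.1 hs
    obtain ⟨m, hm, hs⟩ := Part.mem_bind_iff.1 hs
    obtain ⟨m', hm', -⟩ := (Part.mem_map_iff _).1 hs
    intro j hj
    rcases Nat.lt_succ_iff_lt_or_eq.1 hj with hj | rfl
    · exact dom_of_partialSum_dom (Part.dom_iff_mem.2 ⟨r, hr⟩) j hj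
    · exact ⟨Part.dom_iff_mem.2 ⟨m, hm⟩, Part.dom_iff_mem.2 ⟨m', hm'⟩⟩

theorem primrec_stepCode {α : Type*} [Primcodable α] {L s m m' : α → ℕ} (hL : Primrec L)
    (hs : Primrec s) (hm : Primrec m) (hm' : Primrec m') :
    Primrec fun a => stepCode (L a) (s a) (m a) (m' a) :=
  primrec_codeAdd.comp hs (primrec_codeMul.comp
    (primrec_codeAdd.comp hm (primrec_codeNegate.comp hm'))
    (primrec_dyadicCode.comp (Primrec.const 1) hL))

theorem partrec_partialSum {α : Type*} [Primcodable α] {d L : α → ℕ} {P Q : α → ℕ →. ℕ}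
    {i : α → ℕ} (hd : Computable d) (hL : Primrec L) (hP : Partrec₂ P) (hQ : Partrec₂ Q)
    (hi : Computable i) : Partrec fun a => partialSum (d a) (L a) (P a) (Q a) (i a) := by
  refine Partrec.nat_rec (h := fun a (q : ℕ × ℕ) => (P a q.1).bind fun m =>
    (Q a q.1).map fun m' => stepCode (L a) q.2 m m') hi hd.partrec ?_
  refine Partrec.bind (f := fun p : α × ℕ × ℕ => P p.1 p.2.1)
    (g := fun p m => (Q p.1 p.2.1).map fun m' => stepCode (L p.1) p.2.2 m m')
    (Partrec.comp hP (Computable.fst.pair (Computable.fst.comp Computable.snd))) ?_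
  refine Partrec.map (f := fun p : (α × ℕ × ℕ) × ℕ => Q p.1.1 p.1.2.1)
    (g := fun p m' => stepCode (L p.1.1) p.1.2.2 p.2 m')
    (Partrec.comp hQ ((Computable.fst.comp Computable.fst).pair
      (Computable.fst.comp (Computable.snd.comp Computable.fst)))) ?_
  exact (primrec_stepCode (hL.comp (Primrec.fst.comp (Primrec.fst.comp Primrec.fst)))
    (Primrec.snd.comp (Primrec.snd.comp (Primrec.fst.comp Primrec.fst)))
    (Primrec.snd.comp Primrec.fst) Primrec.snd).to_comp.to₂

/-! ### Winning is a `Π⁰₂` property -/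

/-- The output for the function with index `n` and precision `k` on the dyadic interval `j` of
level `L`. -/
def intervalOutput (c : OracleCode) (n k L : ℕ) : ℕ →. ℕ := fun j =>
  c.eval (dyadicOracle j L) (Nat.pair n k)

theorem partrec_intervalOutput (c : OracleCode) {α : Type*} [Primcodable α] {n k L : α → ℕ}
    (hn : Primrec n) (hk : Primrec k) (hL : Primrec L) :
    Partrec₂ fun a => intervalOutput c (n a) (k a) (L a) :=
  Partrec.comp (c.eval_partrec partrec_dyadicOracle)
    (Computable.pair (Computable.pair Computable.snd (hL.to_comp.comp Computable.fst))
      (Primrec₂.natPair.comp (hn.comp Primrec.fst) (hk.comp Primrec.fst)).to_comp)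

/-- A finite certificate, in the grid of level `L` with machine precision `k`, that Evader is not
caught before time `N`. The approximate distance at every node exceeds the bound
`2 / 2 ^ k * (1 + N)` of the total error: `2 / 2 ^ k` from the initial distance and as much per unit
of time from the two velocities. Here `d` approximates the initial distance. -/
def IsCertificate (cu cv : OracleCode) (d : ℕ → ℕ) (n N k L : ℕ) : Prop :=
  ∀ i ≤ N * 2 ^ L,
    ∃ s ∈ partialSum (d k) L (intervalOutput cv n k L) (intervalOutput cu n k L) i,
      CodeLT (dyadicCode (2 * (1 + N)) k) s

/-- To have a certificate is recursively enumerable: the condition on a single node is, and finitely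
many nodes are checked at a common stage. -/
theorem isPi02_of_certificates (cu cv : OracleCode) {d : ℕ → ℕ} (hd : Computable d) :
    IsPi02 {n | ∀ N, ∃ k L, IsCertificate cu cv d n N k L} := by
  have h1 : Primrec fun a : (ℕ × ℕ × ℕ × ℕ) × ℕ => a.1.1 := Primrec.fst.comp Primrec.fst
  have h2 : Primrec fun a : (ℕ × ℕ × ℕ × ℕ) × ℕ => a.1.2.1 :=
    Primrec.fst.comp (Primrec.snd.comp Primrec.fst)
  have h3 : Primrec fun a : (ℕ × ℕ × ℕ × ℕ) × ℕ => a.1.2.2.1 :=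
    Primrec.fst.comp (Primrec.snd.comp (Primrec.snd.comp Primrec.fst))
  have h4 : Primrec fun a : (ℕ × ℕ × ℕ × ℕ) × ℕ => a.1.2.2.2 :=
    Primrec.snd.comp (Primrec.snd.comp (Primrec.snd.comp Primrec.fst))
  have hre := rePred_exists_mem_of_partrec
    (partrec_partialSum (hd.comp h3.to_comp) h4 (partrec_intervalOutput cv h1 h3 h4)
      (partrec_intervalOutput cu h1 h3 h4) Computable.snd)
    (p := fun a s => CodeLT (dyadicCode (2 * (1 + a.1.2.1)) a.1.2.2.1) s)
    (primrecRel_codeLT.comp (primrec_dyadicCode.comp (Primrec.nat_mul.comp (Primrec.const 2)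
      (Primrec.nat_add.comp (Primrec.const 1) (h2.comp Primrec.fst))) (h3.comp Primrec.fst))
      Primrec.snd)
  obtain ⟨D, hD, hmono, hiff⟩ := exists_primrec_stages_of_rePred hre
  refine ⟨fun n N b => ∀ i < N * 2 ^ b.unpair.2.unpair.1 + 1,
    D ((n, N, b.unpair.1, b.unpair.2.unpair.1), i) b.unpair.2.unpair.2, ?_, fun n => ?_⟩
  · have e1 : Primrec fun p : ℕ × ℕ × ℕ => p.2.2.unpair.1 :=
      Primrec.fst.comp (Primrec.unpair.comp (Primrec.snd.comp Primrec.snd))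
    have e2 : Primrec fun p : ℕ × ℕ × ℕ => p.2.2.unpair.2.unpair :=
      Primrec.unpair.comp (Primrec.snd.comp (Primrec.unpair.comp (Primrec.snd.comp Primrec.snd)))
    have e3 := Primrec.fst.comp e2
    have hR : PrimrecRel fun (i : ℕ) (p : ℕ × ℕ × ℕ) =>
        D ((p.1, p.2.1, p.2.2.unpair.1, p.2.2.unpair.2.unpair.1), i) p.2.2.unpair.2.unpair.2 :=
      hD.comp (Primrec.pair (Primrec.pair (Primrec.fst.comp Primrec.snd)
        (Primrec.pair (Primrec.fst.comp (Primrec.snd.comp Primrec.snd))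
          ((e1.comp Primrec.snd).pair (e3.comp Primrec.snd)))) Primrec.fst)
        ((Primrec.snd.comp e2).comp Primrec.snd)
    refine PrimrecPred.computablePred ((hR.forall_mem_list.comp (Primrec.list_range.comp
      (Primrec.succ.comp (Primrec.nat_mul.comp (Primrec.fst.comp Primrec.snd)
        (primrec_two_pow.comp e3)))) Primrec.id).of_eq fun p => ?_)
    simp
  · refine forall_congr' fun N => ⟨?_, ?_⟩
    · rintro ⟨k, L, h⟩
      have : ∀ i, ∃ s, i ≤ N * 2 ^ L → D ((n, N, k, L), i) s := by
        intro i
        by_cases hi : i ≤ N * 2 ^ L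
        · obtain ⟨s, hs⟩ := (hiff ((n, N, k, L), i)).1 (h i hi)
          exact ⟨s, fun _ => hs⟩
        · exact ⟨0, fun h => absurd h hi⟩
      choose s hs using this
      refine ⟨Nat.pair k (Nat.pair L ((Finset.range (N * 2 ^ L + 1)).sup s)), ?_⟩
      simp only [Nat.unpair_pair]
      exact fun i hi => hmono _ _ _ (Finset.le_sup (Finset.mem_range.2 hi)) (hs i (by lia))
    · rintro ⟨b, hb⟩
      exact ⟨_, _, fun i hi => (hiff _).2 ⟨_, hb i (by lia)⟩⟩

theorem position_sub_position {x₀ y₀ : ℝ} {u v : ℝ → ℝ} (hu : Continuous u) (hv : Continuous v)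
    (t : ℝ) : position y₀ v t - position x₀ u t = (y₀ - x₀) + ∫ s in 0..t, (v s - u s) := by
  rw [intervalIntegral.integral_sub (hv.intervalIntegrable _ _) (hu.intervalIntegrable _ _),
    position, position]
  ring

theorem continuous_distance {x₀ y₀ : ℝ} {u v : ℝ → ℝ} (hu : Continuous u) (hv : Continuous v) :
    Continuous fun t : ℝ => (y₀ - x₀) + ∫ s in 0..t, (v s - u s) :=
  continuous_const.add (intervalIntegral.continuous_primitive
    (fun _ _ => (hv.sub hu).intervalIntegrable _ _) 0)

/-- The distance is continuous and positive at the start, so it avoids `0` only if it stays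
positive. -/
theorem evaderWins_iff_forall_pos {x₀ y₀ : ℝ} (hxy : x₀ < y₀) {u v : ℝ → ℝ} (hu : Continuous u)
    (hv : Continuous v) : EvaderWins x₀ y₀ u v ↔
      ∀ N : ℕ, ∀ t ∈ Icc 0 (N : ℝ), 0 < (y₀ - x₀) + ∫ s in 0..t, (v s - u s) := by
  constructor
  · intro h N t ht
    by_contra! hneg
    obtain ⟨s, hs, hs0⟩ := intermediate_value_Icc' ht.1
      (continuous_distance (x₀ := x₀) (y₀ := y₀) hu hv).continuousOn
      (show (0 : ℝ) ∈ Icc _ _ from ⟨hneg, by simpa using hxy.le⟩)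
    refine h s hs.1 (sub_eq_zero.1 ?_).symm
    rw [position_sub_position hu hv]
    exact hs0
  · intro h t ht heq
    have := h ⌈t⌉₊ t ⟨ht, Nat.le_ceil t⟩
    rw [← position_sub_position hu hv, heq, sub_self] at this
    exact this.false

theorem abs_sub_sub_sub_le {a b a' b' ε : ℝ} (h : |a - a'| ≤ ε) (h' : |b - b'| ≤ ε) :
    |(a - b) - (a' - b')| ≤ 2 * ε := by
  rw [abs_le] at *
  constructor <;> linarith [h.1, h.2, h'.1, h'.2]

/-- Certificates are sound and complete. For completeness, the distance has a positive minimum on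
`[0, N]` by compactness, and twice the error bound is below it for a high precision `k`. -/
theorem exists_certificate_iff {x₀ y₀ : ℝ} {u v : ℕ → ℝ → ℝ} {cu cv : OracleCode}
    (hcu : Computes cu u) (hcv : Computes cv v) {d : ℕ → ℕ}
    (hd : ∀ k, |(y₀ - x₀) - (ratOfNat (d k) : ℝ)| ≤ 2 * (1 / 2 ^ k)) (n N : ℕ) :
    (∃ k L, IsCertificate cu cv d n N k L) ↔
      ∀ t ∈ Icc 0 (N : ℝ), 0 < (y₀ - x₀) + ∫ s in 0..t, (v n s - u n s) := by
  have hw : Continuous fun s => v n s - u n s := (hcv.continuous n).sub (hcu.continuous n)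
  -- On a grid where all machines halt, their outputs are step functions approximating the velocity.
  have hstep {k L : ℕ} {p q : ℕ → ℕ} (hpq : ∀ j < N * 2 ^ L,
      p j ∈ intervalOutput cv n k L j ∧ q j ∈ intervalOutput cu n k L j) :
      ∀ j < N * 2 ^ L, ∀ s ∈ Icc ((j : ℝ) * (1 / 2 ^ L)) ((j + 1) * (1 / 2 ^ L)),
        |(v n s - u n s) - (ratOfNat (p j) - ratOfNat (q j) : ℝ)| ≤ 2 * (1 / 2 ^ k) := by
    intro j hj s hs
    rw [mul_one_div, mul_one_div] at hs
    exact abs_sub_sub_sub_le (hcv.abs_sub_lt (hpq j hj).1 hs).le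
      (hcu.abs_sub_lt (hpq j hj).2 hs).le
  have hlen (L : ℕ) : ((N * 2 ^ L : ℕ) : ℝ) * (1 / 2 ^ L) = N := by
    push_cast; field_simp
  -- The certificate inequality at a node, as an inequality between reals.
  have hnode {k L : ℕ} {p q : ℕ → ℕ} (hpq : ∀ j < N * 2 ^ L,
      p j ∈ intervalOutput cv n k L j ∧ q j ∈ intervalOutput cu n k L j) (i : ℕ)
      (hi : i ≤ N * 2 ^ L) :
      (∃ s ∈ partialSum (d k) L (intervalOutput cv n k L) (intervalOutput cu n k L) i,
        CodeLT (dyadicCode (2 * (1 + N)) k) s) ↔ 2 * (1 / 2 ^ k) * (1 + N : ℝ) < ratOfNat (d k) +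
          1 / 2 ^ L * ∑ j ∈ Finset.range i, (ratOfNat (p j) - ratOfNat (q j) : ℝ) := by
    obtain ⟨s, hs, hs'⟩ := exists_mem_partialSum (d := d k) (L := L) (i := i)
      fun j hj => hpq j (hj.trans_le hi)
    have h1 : CodeLT (dyadicCode (2 * (1 + N)) k) s ↔ 2 * (1 / 2 ^ k) * (1 + N : ℝ) <
        ratOfNat (d k) +
          1 / 2 ^ L * ∑ j ∈ Finset.range i, (ratOfNat (p j) - ratOfNat (q j) : ℝ) := by
      rw [codeLT_iff, hs', ratOfNat_dyadicCode, ← Rat.cast_lt (K := ℝ)]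
      push_cast
      rw [show (2 * (1 + N) / 2 ^ k : ℝ) = 2 * (1 / 2 ^ k) * (1 + N) by ring]
    rw [← h1]
    exact ⟨fun ⟨s', hm, hlt⟩ => Part.mem_unique hm hs ▸ hlt, fun h => ⟨s, hs, h⟩⟩
  constructor
  · rintro ⟨k, L, hcert⟩
    obtain ⟨_, hs, -⟩ := hcert _ le_rfl
    have hdom := dom_of_partialSum_dom (Part.dom_iff_mem.2 ⟨_, hs⟩)
    have : ∀ j, ∃ p q, j < N * 2 ^ L →
        p ∈ intervalOutput cv n k L j ∧ q ∈ intervalOutput cu n k L j := by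
      intro j
      by_cases hj : j < N * 2 ^ L
      · exact ⟨_, _, fun _ => ⟨Part.get_mem (hdom j hj).1, Part.get_mem (hdom j hj).2⟩⟩
      · exact ⟨0, 0, fun h => absurd h hj⟩
    choose p q hpq using this
    have := pos_of_pos_on_nodes hw (d := y₀ - x₀) (by positivity) (by positivity) (hstep hpq)
      fun i hi => by
        have h1 := (hnode hpq i hi).1 (hcert i hi)
        have h2 := (abs_le.1 (hd k)).1
        rw [hlen]
        linarith
    rwa [hlen] at this
  · intro hpos
    obtain ⟨t₀, ht₀, hmin⟩ := isCompact_Icc.exists_isMinOn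
      (nonempty_Icc.2 (Nat.cast_nonneg (α := ℝ) N))
      (continuous_distance (x₀ := x₀) (y₀ := y₀)
        (hcu.continuous n) (hcv.continuous n)).continuousOn
    have hδ := hpos t₀ ht₀
    set δ := (y₀ - x₀) + ∫ s in 0..t₀, (v n s - u n s)
    obtain ⟨k, hk⟩ := exists_pow_lt_of_lt_one
      (show 0 < δ / (4 * (1 + N)) by positivity) (one_half_lt_one (α := ℝ))
    rw [lt_div_iff₀ (by positivity)] at hk
    obtain ⟨L₁, h₁⟩ := hcu.exists_forall_dom n k N
    obtain ⟨L₂, h₂⟩ := hcv.exists_forall_dom n k N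
    obtain ⟨L, hL₁, hL₂⟩ : ∃ L, L₁ ≤ L ∧ L₂ ≤ L := ⟨max L₁ L₂, le_max_left _ _, le_max_right _ _⟩
    have : ∀ j, ∃ p q, j < N * 2 ^ L →
        p ∈ intervalOutput cv n k L j ∧ q ∈ intervalOutput cu n k L j := by
      intro j
      by_cases hj : j < N * 2 ^ L
      · exact ⟨_, _, fun _ => ⟨Part.get_mem (h₂ L hL₂ j hj), Part.get_mem (h₁ L hL₁ j hj)⟩⟩
      · exact ⟨0, 0, fun h => absurd h hj⟩
    choose p q hpq using this
    refine ⟨k, L, fun i hi => (hnode hpq i hi).2 ?_⟩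
    have hiN : (i : ℝ) * (1 / 2 ^ L) ≤ N := by
      rw [← hlen L]
      gcongr
    have h3 := abs_integral_sub_sum_le hw (by positivity) (hstep hpq) i hi
    have h4 : δ ≤ (y₀ - x₀) + ∫ s in 0..(i : ℝ) * (1 / 2 ^ L), (v n s - u n s) :=
      hmin ⟨by positivity, hiN⟩
    have h5 := (abs_le.1 (hd k)).2
    have h6 := (abs_le.1 h3).2
    have h7 : 2 * (1 / 2 ^ k : ℝ) * (i * (1 / 2 ^ L)) ≤ 2 * (1 / 2 ^ k) * N := by gcongr
    rw [one_div_pow] at hk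
    linarith

theorem IsComputableReal.exists_difference {x₀ y₀ : ℝ} (hx₀ : IsComputableReal x₀)
    (hy₀ : IsComputableReal y₀) : ∃ d : ℕ → ℕ, Computable d ∧
      ∀ k, |(y₀ - x₀) - (ratOfNat (d k) : ℝ)| ≤ 2 * (1 / 2 ^ k) := by
  obtain ⟨gx, hgx, hx⟩ := hx₀
  obtain ⟨gy, hgy, hy⟩ := hy₀
  refine ⟨fun k => codeAdd (gy k) (codeNegate (gx k)),
    primrec_codeAdd.to_comp.comp hgy (primrec_codeNegate.to_comp.comp hgx), fun k => ?_⟩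
  rw [ratOfNat_codeAdd, ratOfNat_codeNegate, Rat.cast_add, Rat.cast_neg, ← sub_eq_add_neg]
  exact abs_sub_sub_sub_le (hy k) (hx k)

theorem isPi02_evaderWins {x₀ y₀ : ℝ} (hx₀ : IsComputableReal x₀) (hy₀ : IsComputableReal y₀)
    (hxy : x₀ < y₀) {u v : ℕ → ℝ → ℝ} (hu : IsComputableSeq u) (hv : IsComputableSeq v) :
    IsPi02 {n | EvaderWins x₀ y₀ (u n) (v n)} := by
  obtain ⟨cu, hcu⟩ : ∃ c, Computes c u := hu
  obtain ⟨cv, hcv⟩ : ∃ c, Computes c v := hv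
  obtain ⟨d, hd, hd'⟩ := hx₀.exists_difference hy₀
  convert isPi02_of_certificates cu cv hd using 1
  ext n
  simp only [mem_ofPred_eq, exists_certificate_iff hcu hcv hd',
    evaderWins_iff_forall_pos hxy (hcu.continuous n) (hcv.continuous n)]

/-! ### A universal `Π⁰₂` set -/

theorem code_eval_dom_iff (c : Code) (m : ℕ) :
    (c.eval m).Dom ↔ ∃ s, (c.evaln s m).isSome := by
  simp only [Part.dom_iff_mem, Code.evaln_complete, Option.isSome_iff_exists]
  exact exists_comm

theorem primrecPred_evaln_isSome {α : Type*} [Primcodable α] {s m : α → ℕ} {c : α → Code}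
    (hs : Primrec s) (hc : Primrec c) (hm : Primrec m) :
    PrimrecPred fun a => ((c a).evaln (s a) (m a)).isSome = true := by
  refine Primrec.primrecPred ?_
  simp only [Bool.decide_eq_true]
  exact Primrec.option_isSome.comp (Code.primrec_evaln.comp ((hs.pair hc).pair hm))

theorem IsPi02.exists_computable_bool {A : Set ℕ} (hA : IsPi02 A) : ∃ χ : ℕ → ℕ → ℕ → Bool,
    (Computable fun p : (ℕ × ℕ) × ℕ => χ p.1.1 p.1.2 p.2) ∧
      ∀ n, n ∈ A ↔ ∀ a, ∃ b, χ n a b = true := by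
  classical
  obtain ⟨R, ⟨hdec, hR⟩, hA⟩ := hA
  refine ⟨fun n a b => decide (R n a b), ?_, fun n => by simpa using hA n⟩
  refine (hR.comp (f := fun p : ℕ × ℕ × ℕ => decide (R p.1 p.2.1 p.2.2))
    (Computable.pair (Computable.fst.comp Computable.fst)
      (Computable.pair (Computable.snd.comp Computable.fst) Computable.snd))).of_eq fun p => ?_
  congr

/-- The set of all pairs of a program and an argument such that the program halts on this argument
paired with any number. -/
def universalPi02 : Set ℕ :=
  {e | ∀ a, ((ofNat Code e.unpair.1).eval (Nat.pair e.unpair.2 a)).Dom}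

theorem isPi02Complete_universalPi02 : IsPi02Complete universalPi02 := by
  have e1 : Primrec fun p : ℕ × ℕ × ℕ => p.1.unpair := Primrec.unpair.comp Primrec.fst
  refine ⟨⟨fun e a b => ((ofNat Code e.unpair.1).evaln b (Nat.pair e.unpair.2 a)).isSome,
    (primrecPred_evaln_isSome (Primrec.snd.comp Primrec.snd)
      ((Primrec.ofNat Code).comp (Primrec.fst.comp e1)) (Primrec₂.natPair.comp
        (Primrec.snd.comp e1) (Primrec.fst.comp Primrec.snd))).computablePred,
    fun e => forall_congr' fun a => code_eval_dom_iff _ _⟩, ?_⟩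
  intro B hB
  obtain ⟨χ, hχ, hB⟩ := hB.exists_computable_bool
  have hsearch : Partrec fun m : ℕ => Nat.rfind fun b =>
      Part.some (χ m.unpair.1 m.unpair.2 b) := by
    refine Partrec.rfind (Computable.partrec ?_)
    exact hχ.comp (Computable.pair (Computable.unpair.comp Computable.fst) Computable.snd)
  obtain ⟨c, hc⟩ := Code.exists_code.1 (Partrec.nat_iff.1 hsearch)
  refine ⟨fun n => Nat.pair (encode c) n,
    (Primrec₂.natPair.comp (Primrec.const _) Primrec.id).to_comp, fun n => ?_⟩
  refine (hB n).trans ?_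
  refine forall_congr' fun a => ?_
  simp only [Nat.unpair_pair, ofNat_encode, hc]
  exact ⟨fun ⟨b, hb⟩ => Nat.rfind_dom.2 ⟨b, by simpa using hb, fun _ => trivial⟩,
    fun h => let ⟨b, hb, _⟩ := Nat.rfind_dom.1 h; ⟨b, by simpa using hb⟩⟩

/-- The halting problem is `Π⁰₂`, with a dummy universal quantifier. -/
theorem IsPi02Complete.not_computablePred {A : Set ℕ} (hA : IsPi02Complete A) :
    ¬ ComputablePred fun n => n ∈ A := by
  intro h
  have hred := hA.2 {n | ((ofNat Code n).eval 0).Dom}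
    ⟨fun n _ b => ((ofNat Code n).evaln b 0).isSome,
      (primrecPred_evaln_isSome (Primrec.snd.comp Primrec.snd)
        ((Primrec.ofNat Code).comp Primrec.fst) (Primrec.const 0)).computablePred,
      fun n => (code_eval_dom_iff _ _).trans ⟨fun h _ => h, fun h => h 0⟩⟩
  have hhalt : (fun c : Code => (c.eval 0).Dom) ≤₀ fun n => ((ofNat Code n).eval 0).Dom :=
    ⟨encode, Computable.encode, fun c => by simp⟩
  exact ComputablePred.halting_problem 0
    (ComputablePred.computable_of_manyOneReducible (hhalt.trans hred) h)

/-! ### Reals that measure how fast a search succeeds -/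

/-- The least `b` with `χ b`, or `k` if there is none below `k`. The recursion tests the current
candidate and increments it on failure, so no bounded search is needed. -/
def searchStage (χ : ℕ → Bool) : ℕ → ℕ := Nat.rec 0 fun _ s => bif χ s then s else s + 1

theorem searchStage_succ (χ : ℕ → Bool) (k : ℕ) : searchStage χ (k + 1) =
    bif χ (searchStage χ k) then searchStage χ k else searchStage χ k + 1 := rfl

theorem searchStage_of_forall {χ : ℕ → Bool} : ∀ {k : ℕ}, (∀ b < k, χ b = false) →
    searchStage χ k = k
  | 0, _ => rfl
  | k + 1, h => by
    rw [searchStage_succ, searchStage_of_forall fun b hb => h b (by lia), h k k.lt_succ_self,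
      cond_false]

theorem searchStage_add_of_true {χ : ℕ → Bool} {b : ℕ} (hlt : ∀ j < b, χ j = false)
    (hb : χ b = true) (i : ℕ) : searchStage χ (b + i) = b := by
  induction i with
  | zero => exact searchStage_of_forall hlt
  | succ i ih => rw [← add_assoc, searchStage_succ, ih, hb, cond_true]

open Classical in
/-- The number `1 / 2 ^ b` for the least `b` with `χ b`, and `0` if there is none. It can be
computed from `χ`, though its positivity cannot be decided. -/
noncomputable def searchReal (χ : ℕ → Bool) : ℝ :=
  if h : ∃ b, χ b = true then 1 / 2 ^ Nat.find h else 0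

theorem searchReal_nonneg (χ : ℕ → Bool) : 0 ≤ searchReal χ := by
  unfold searchReal
  split_ifs <;> positivity

theorem searchReal_le_one (χ : ℕ → Bool) : searchReal χ ≤ 1 := by
  unfold searchReal
  split_ifs
  · exact div_le_one_of_le₀ (one_le_pow₀ one_le_two) (by positivity)
  · exact zero_le_one

theorem searchReal_pos_iff (χ : ℕ → Bool) : 0 < searchReal χ ↔ ∃ b, χ b = true := by
  unfold searchReal
  split_ifs with h
  · exact iff_of_true (by positivity) h
  · exact iff_of_false (lt_irrefl _) h

theorem abs_searchReal_sub_le (χ : ℕ → Bool) (k : ℕ) :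
    |searchReal χ - 1 / 2 ^ searchStage χ k| ≤ 1 / 2 ^ k := by
  classical
  unfold searchReal
  split_ifs with h
  · have hlt : ∀ j < Nat.find h, χ j = false := fun j hj => by simpa using Nat.find_min h hj
    rcases le_total (Nat.find h) k with hk | hk
    · obtain ⟨i, rfl⟩ := Nat.exists_eq_add_of_le hk
      rw [searchStage_add_of_true hlt (Nat.find_spec h), sub_self, abs_zero]
      positivity
    · rw [searchStage_of_forall fun b hb => hlt b (hb.trans_le hk), abs_le]
      have h1 : (1 : ℝ) / 2 ^ Nat.find h ≤ 1 / 2 ^ k :=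
        one_div_le_one_div_of_le (by positivity) (pow_le_pow_right₀ one_le_two hk)
      have h2 : (0 : ℝ) ≤ 1 / 2 ^ Nat.find h := by positivity
      constructor <;> linarith
  · push Not at h
    rw [searchStage_of_forall fun b _ => by simpa using h b, zero_sub, abs_neg,
      abs_of_nonneg (by positivity)]

theorem computable_searchStage {α : Type*} [Primcodable α] {χ : α → ℕ → Bool} {k : α → ℕ}
    (hχ : Computable₂ χ) (hk : Computable k) : Computable fun a => searchStage (χ a) (k a) :=
  Computable.nat_rec (h := fun a q => bif χ a q.2 then q.2 else q.2 + 1) hk (Computable.const 0)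
    (Computable.cond (hχ.comp Computable.fst (Computable.snd.comp Computable.snd))
      (Computable.snd.comp Computable.snd)
      (Computable.succ.comp (Computable.snd.comp Computable.snd))).to₂

/-! ### A train of dips -/

/-- A speed profile on `[0, 1]` that vanishes at both ends and whose integral, `dipDepth`, climbs
from `0` to `1` and returns to `0`. -/
noncomputable def dipSpeed (s : ℝ) : ℝ := 32 * (s * ((1 - s) * (1 - 2 * s)))

/-- The integral of `dipSpeed`, with maximum `1` on `[0, 1]`, attained at `1 / 2`. -/
noncomputable def dipDepth (s : ℝ) : ℝ := 16 * (s * (1 - s)) ^ 2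

theorem hasDerivAt_dipDepth (s : ℝ) : HasDerivAt dipDepth (dipSpeed s) s := by
  have h := ((((hasDerivAt_id s).mul ((hasDerivAt_id s).const_sub 1)).pow 2).const_mul 16)
  refine h.congr_deriv ?_
  simp only [dipSpeed, id, Pi.mul_apply]
  ring

theorem continuous_dipSpeed : Continuous dipSpeed := by
  unfold dipSpeed; fun_prop

theorem dipDepth_le_one {s : ℝ} (hs : s ∈ Icc (0 : ℝ) 1) : dipDepth s ≤ 1 := by
  unfold dipDepth
  have h0 : 0 ≤ s * (1 - s) := mul_nonneg hs.1 (sub_nonneg.2 hs.2)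
  nlinarith [sq_nonneg (s - 1 / 2)]

theorem abs_dipSpeed_le {s : ℝ} (hs : s ∈ Icc (0 : ℝ) 1) :
    |dipSpeed s| ≤ 32 * s ∧ |dipSpeed s| ≤ 32 * (1 - s) := by
  obtain ⟨h0, h1⟩ := hs
  have h2 : |1 - 2 * s| ≤ 1 := abs_le.2 ⟨by linarith, by linarith⟩
  have h3 : 0 ≤ 1 - s := sub_nonneg.2 h1
  have h4 := abs_nonneg (1 - 2 * s)
  rw [dipSpeed, abs_mul, abs_mul, abs_mul, abs_of_nonneg h0, abs_of_nonneg h3,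
    abs_of_nonneg (by norm_num : (0 : ℝ) ≤ 32)]
  have h5 : (1 - s) * |1 - 2 * s| ≤ 1 - s := mul_le_of_le_one_right h3 h2
  have h6 := mul_le_mul_of_nonneg_left h5 h0
  constructor <;> nlinarith

theorem abs_dipSpeed_sub_le {s t : ℝ} (hs : s ∈ Icc (0 : ℝ) 1) (ht : t ∈ Icc (0 : ℝ) 1) :
    |dipSpeed s - dipSpeed t| ≤ 512 * |s - t| := by
  obtain ⟨h0, h1⟩ := hs
  obtain ⟨h0', h1'⟩ := ht
  have h : dipSpeed s - dipSpeed t =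
      32 * (1 - 3 * (s + t) + 2 * (s * s + s * t + t * t)) * (s - t) := by
    unfold dipSpeed; ring
  rw [h, abs_mul]
  gcongr
  have e1 : s * s ≤ 1 := mul_le_one₀ h1 h0 h1
  have e2 : s * t ≤ 1 := mul_le_one₀ h1 h0' h1'
  have e3 : t * t ≤ 1 := mul_le_one₀ h1' h0' h1'
  have e4 := mul_nonneg h0 h0
  have e5 := mul_nonneg h0 h0'
  have e6 := mul_nonneg h0' h0'
  rw [abs_le]
  constructor <;> linarith

/-- The speed that makes a dip of depth `κ a` in each time interval `[a, a + 1]`. At negative times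
the factor is `κ 0`, because the natural floor is `0` there; this keeps the function Lipschitz on the
whole line. -/
noncomputable def dipTrain (κ : ℕ → ℝ) (t : ℝ) : ℝ := κ ⌊t⌋₊ * dipSpeed (Int.fract t)

theorem fract_mem_Icc (t : ℝ) : Int.fract t ∈ Icc (0 : ℝ) 1 :=
  ⟨Int.fract_nonneg t, (Int.fract_lt_one t).le⟩

theorem abs_dipTrain_le {κ : ℕ → ℝ} (hκ : ∀ a, |κ a| ≤ 1) (t : ℝ) :
    |dipTrain κ t| ≤ |dipSpeed (Int.fract t)| := by
  rw [dipTrain, abs_mul]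
  exact mul_le_of_le_one_left (abs_nonneg _) (hκ _)

theorem abs_dipTrain_sub_le {κ : ℕ → ℝ} (hκ : ∀ a, |κ a| ≤ 1) (s t : ℝ) :
    |dipTrain κ s - dipTrain κ t| ≤ 512 * |s - t| := by
  wlog hst : s ≤ t generalizing s t
  · rw [abs_sub_comm, abs_sub_comm s]
    exact this t s (le_of_not_ge hst)
  rcases (Int.floor_mono hst).eq_or_lt with h | h
  · have h' : ⌊s⌋₊ = ⌊t⌋₊ := by rw [← Int.floor_toNat, ← Int.floor_toNat, h]
    have hfr : Int.fract s - Int.fract t = s - t := by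
      rw [Int.fract, Int.fract, h]; ring
    rw [dipTrain, dipTrain, h', ← mul_sub, abs_mul, ← hfr]
    exact (mul_le_of_le_one_left (abs_nonneg _) (hκ _)).trans
      (abs_dipSpeed_sub_le (fract_mem_Icc s) (fract_mem_Icc t))
  · -- An integer lies between `s` and `t`, and the speed is small near integers.
    have h1 := (abs_dipTrain_le hκ s).trans (abs_dipSpeed_le (fract_mem_Icc s)).2
    have h2 := (abs_dipTrain_le hκ t).trans (abs_dipSpeed_le (fract_mem_Icc t)).1
    have h3 : (⌊s⌋ + 1 : ℝ) ≤ ⌊t⌋ := by exact_mod_cast h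
    have h4 := Int.floor_add_fract s
    have h5 := Int.floor_add_fract t
    have h6 := Int.fract_nonneg t
    have h7 := Int.fract_lt_one s
    rw [abs_sub_comm s, abs_of_nonneg (sub_nonneg.2 hst)]
    have := abs_sub (dipTrain κ s) (dipTrain κ t)
    linarith

theorem continuous_dipTrain {κ : ℕ → ℝ} (hκ : ∀ a, |κ a| ≤ 1) : Continuous (dipTrain κ) := by
  refine (LipschitzWith.of_dist_le_mul (K := 512) fun s t => ?_).continuous
  simpa [Real.dist_eq] using abs_dipTrain_sub_le hκ s t

theorem dipTrain_eq_on_Icc (κ : ℕ → ℝ) (a : ℕ) {t : ℝ} (ht : t ∈ Icc (a : ℝ) (a + 1)) :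
    dipTrain κ t = κ a * dipSpeed (t - a) := by
  rcases ht.2.eq_or_lt with rfl | hlt
  · have : Int.fract ((a : ℝ) + 1) = 0 := by
      rw [Int.fract_add_one, Int.fract_natCast]
    simp [dipTrain, this, dipSpeed]
  · have h0 : (0 : ℝ) ≤ t := (Nat.cast_nonneg a).trans ht.1
    have h1 : ⌊t⌋₊ = a := (Nat.floor_eq_iff h0).2 ⟨ht.1, hlt⟩
    have h2 : Int.fract t = t - a := by
      refine Int.fract_eq_iff.2 ⟨by linarith [ht.1], by linarith, a, by simp⟩
    rw [dipTrain, h1, h2]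

theorem integral_dipTrain_of_mem_Icc (κ : ℕ → ℝ) (a : ℕ) {t : ℝ}
    (ht : t ∈ Icc (a : ℝ) (a + 1)) : ∫ s in (a : ℝ)..t, dipTrain κ s = κ a * dipDepth (t - a) := by
  have hcongr : ∫ s in (a : ℝ)..t, dipTrain κ s = ∫ s in (a : ℝ)..t, κ a * dipSpeed (s - a) := by
    refine intervalIntegral.integral_congr fun s hs => dipTrain_eq_on_Icc κ a ?_
    rw [uIcc_of_le ht.1] at hs
    exact ⟨hs.1, hs.2.trans ht.2⟩
  rw [hcongr, intervalIntegral.integral_const_mul,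
    intervalIntegral.integral_comp_sub_right (fun s => dipSpeed s), sub_self,
    intervalIntegral.integral_eq_sub_of_hasDerivAt (fun s _ => hasDerivAt_dipDepth s)
      (continuous_dipSpeed.intervalIntegrable _ _)]
  simp [dipDepth]

theorem integral_dipTrain {κ : ℕ → ℝ} (hκ : ∀ a, |κ a| ≤ 1) {t : ℝ} (ht : 0 ≤ t) :
    ∫ s in 0..t, dipTrain κ s = κ ⌊t⌋₊ * dipDepth (t - ⌊t⌋₊) := by
  have hint : ∀ a b : ℝ, IntervalIntegrable (dipTrain κ) MeasureTheory.volume a b :=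
    (continuous_dipTrain hκ).intervalIntegrable
  have hzero : ∀ a : ℕ, ∫ s in 0..(a : ℝ), dipTrain κ s = 0 := by
    intro a
    induction a with
    | zero => simp
    | succ a ih =>
      rw [← intervalIntegral.integral_add_adjacent_intervals (hint 0 a) (hint a _), ih,
        integral_dipTrain_of_mem_Icc κ a ⟨by simp, by simp⟩]
      simp [dipDepth]
  rw [← intervalIntegral.integral_add_adjacent_intervals (hint 0 ⌊t⌋₊) (hint _ t), hzero, zero_add,
    integral_dipTrain_of_mem_Icc κ _ ⟨Nat.floor_le ht, (Nat.lt_floor_add_one t).le⟩]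

/-- The distance at time `a + 1 / 2` is `(y₀ - x₀) * (1 - κ a)`, and this is its minimum on
`[a, a + 1]`. -/
theorem evaderWins_dipTrain_iff {x₀ y₀ : ℝ} (hxy : x₀ < y₀) {κ : ℕ → ℝ}
    (hκ : ∀ a, κ a ∈ Icc (0 : ℝ) 1) :
    EvaderWins x₀ y₀ (fun _ => 0) (fun t => -((y₀ - x₀) * dipTrain κ t)) ↔ ∀ a, κ a < 1 := by
  have hδ : 0 < y₀ - x₀ := sub_pos.2 hxy
  have habs : ∀ a, |κ a| ≤ 1 := fun a => abs_le.2 ⟨by linarith [(hκ a).1], (hκ a).2⟩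
  have hmeet (t : ℝ) (ht : 0 ≤ t) : position x₀ (fun _ => 0) t =
      position y₀ (fun t => -((y₀ - x₀) * dipTrain κ t)) t ↔
        κ ⌊t⌋₊ * dipDepth (t - ⌊t⌋₊) = 1 := by
    rw [position, position, intervalIntegral.integral_neg, intervalIntegral.integral_const_mul,
      integral_dipTrain habs ht, intervalIntegral.integral_zero]
    constructor
    · intro h
      refine mul_left_cancel₀ hδ.ne' ?_
      linarith
    · intro h
      rw [h]; ring
  constructor
  · intro h a
    refine (hκ a).2.lt_of_ne fun ha => h (a + 1 / 2) (by positivity) ((hmeet _ (by positivity)).2 ?_)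
    have hfl : ⌊(a : ℝ) + 1 / 2⌋₊ = a :=
      (Nat.floor_eq_iff (by positivity)).2 ⟨by linarith, by linarith⟩
    rw [hfl, ha, dipDepth]
    norm_num
  · intro h t ht heq
    have h1 := (hmeet t ht).1 heq
    have h2 : dipDepth (t - ⌊t⌋₊) ≤ 1 := dipDepth_le_one
      ⟨by linarith [Nat.floor_le ht], by linarith [Nat.lt_floor_add_one t]⟩
    exact h1.not_lt (mul_lt_one_of_nonneg_of_lt_one_left (hκ _).1 (h _) h2)

/-! ### The train of dips is computable -/

/-- A sequence of functions is computable if its values at a real can be computed from one rational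
approximation of the real, of a precision that is computable from the demanded one. -/
theorem isComputableSeq_of_rational_approximation {f : ℕ → ℝ → ℝ} {K : ℕ → ℕ}
    {h : ℕ → ℕ → ℕ → ℕ} (hK : Computable K)
    (hh : Computable fun p : (ℕ × ℕ) × ℕ => h p.1.1 p.1.2 p.2)
    (H : ∀ n k m x, |x - (ratOfNat m : ℝ)| ≤ 1 / 2 ^ K k →
      |f n x - (ratOfNat (h n k m) : ℝ)| < 1 / 2 ^ k) : IsComputableSeq f := by
  obtain ⟨ci, hci⟩ := OracleCode.exists_of_partrec (Partrec.nat_iff.1 Computable.id.partrec)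
  obtain ⟨cK, hcK⟩ := OracleCode.exists_of_partrec (Partrec.nat_iff.1
    (hK.comp (Computable.snd.comp Computable.unpair)).partrec)
  have hu : Computable fun z : ℕ => ((z.unpair.1.unpair, z.unpair.2) : (ℕ × ℕ) × ℕ) :=
    Computable.pair (Computable.unpair.comp (Computable.fst.comp Computable.unpair))
      (Computable.snd.comp Computable.unpair)
  obtain ⟨ch, hch⟩ := OracleCode.exists_of_partrec (Partrec.nat_iff.1 (hh.comp hu).partrec)
  refine ⟨.comp ch (.pair ci (.comp .oracle cK)), fun x g hg n k =>
    ⟨h n k (g (K k)), ?_, H n k _ x (hg (K k))⟩⟩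
  refine Part.mem_bind_iff.2 ⟨Nat.pair (Nat.pair n k) (g (K k)), ?_, ?_⟩
  · simp only [OracleCode.eval, hci, hcK, Seq.seq, PFun.coe_val, Part.map_eq_map, Part.map_some,
      Part.bind_some, Nat.unpair_pair, id]
    exact Part.mem_map _ (Part.mem_bind (Part.mem_some _) (Part.mem_some _))
  · simp [hch]

/-- The natural floor of a coded rational. -/
def codeFloor (m : ℕ) : ℕ := (codePos m - codeNeg m) / (codeDen m + 1)

/-- A code of the fractional part of a coded rational. Since `-b ≡ b * d` modulo `d + 1`, the
numerator `a - b` may be replaced by the natural number `a + b * d`, which is then reduced modulo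
`d + 1`. -/
def codeFract (m : ℕ) : ℕ :=
  ratCode ((codePos m + codeNeg m * codeDen m) % (codeDen m + 1)) 0 (codeDen m)

/-- The function `dipSpeed` on codes of rationals. -/
def codeDipSpeed (m : ℕ) : ℕ :=
  codeMul (dyadicCode 32 0) (codeMul m (codeMul (codeAdd (dyadicCode 1 0) (codeNegate m))
    (codeAdd (dyadicCode 1 0) (codeNegate (codeMul (dyadicCode 2 0) m)))))

theorem codeFloor_eq (m : ℕ) : codeFloor m = ⌊(ratOfNat m : ℝ)⌋₊ := by
  rw [ratOfNat_eq, codeFloor]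
  push_cast
  rcases le_total (codeNeg m) (codePos m) with h | h
  · rw [← Nat.cast_sub h]
    exact_mod_cast (Nat.floor_div_eq_div (K := ℝ) (codePos m - codeNeg m) (codeDen m + 1)).symm
  · rw [Nat.sub_eq_zero_of_le h, Nat.zero_div, Nat.floor_of_nonpos]
    exact div_nonpos_of_nonpos_of_nonneg (sub_nonpos.2 (by exact_mod_cast h)) (by positivity)

theorem ratOfNat_codeFract (m : ℕ) :
    (ratOfNat (codeFract m) : ℝ) = Int.fract (ratOfNat m : ℝ) := by
  rw [codeFract, ratOfNat_ratCode, ratOfNat_eq]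
  generalize codePos m = a
  generalize codeNeg m = b
  generalize codeDen m = d
  have hlt : (a + b * d) % (d + 1) < d + 1 := Nat.mod_lt _ d.succ_pos
  have hdiv := Nat.div_add_mod (a + b * d) (d + 1)
  generalize (a + b * d) % (d + 1) = r at *
  generalize (a + b * d) / (d + 1) = q at *
  push_cast
  rw [sub_zero]
  symm
  refine Int.fract_eq_iff.2 ⟨by positivity, (div_lt_one (by positivity)).2 (by exact_mod_cast hlt),
    q - b, ?_⟩
  have hdiv' : ((d + 1) * q + r : ℝ) = a + b * d := by exact_mod_cast hdiv
  have : (d + 1 : ℝ) ≠ 0 := by positivity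
  push_cast
  field_simp
  linarith

theorem ratOfNat_codeDipSpeed (m : ℕ) :
    (ratOfNat (codeDipSpeed m) : ℝ) = dipSpeed (ratOfNat m) := by
  simp only [codeDipSpeed, dipSpeed, ratOfNat_codeMul, ratOfNat_codeAdd, ratOfNat_codeNegate,
    ratOfNat_dyadicCode]
  push_cast
  ring

theorem primrec_codeFloor : Primrec codeFloor :=
  Primrec.nat_div.comp (Primrec.nat_sub.comp primrec_codePos primrec_codeNeg) primrec_codeDen_succ

theorem primrec_codeFract : Primrec codeFract :=
  primrec_ratCode (Primrec.nat_mod.comp (Primrec.nat_add.comp primrec_codePos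
    (Primrec.nat_mul.comp primrec_codeNeg primrec_codeDen)) primrec_codeDen_succ)
    (Primrec.const 0) primrec_codeDen

theorem primrec_codeDipSpeed : Primrec codeDipSpeed :=
  primrec_codeMul.comp (Primrec.const _) (primrec_codeMul.comp Primrec.id (primrec_codeMul.comp
    (primrec_codeAdd.comp (Primrec.const _) primrec_codeNegate)
    (primrec_codeAdd.comp (Primrec.const _) (primrec_codeNegate.comp
      (primrec_codeMul.comp (Primrec.const _) Primrec.id)))))

theorem abs_mul_mul_sub_le {δ δ' κ κ' w e : ℝ} (hδ : 0 ≤ δ) (hδ' : |δ - δ'| ≤ 2 * e)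
    (hκ : |κ - κ'| ≤ e) (hκ' : |κ'| ≤ 1) (hw : |w| ≤ 32) :
    |δ * (κ * w) - δ' * (κ' * w)| ≤ 32 * (δ + 2) * e := by
  have he : 0 ≤ e := (abs_nonneg _).trans hκ
  have h : δ * (κ * w) - δ' * (κ' * w) = (δ * (κ - κ') + (δ - δ') * κ') * w := by ring
  have h1 : |δ * (κ - κ') + (δ - δ') * κ'| ≤ δ * e + 2 * e * 1 := by
    refine (abs_add_le _ _).trans (add_le_add ?_ ?_)
    · rw [abs_mul, abs_of_nonneg hδ]
      gcongr
    · rw [abs_mul]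
      gcongr
  rw [h, abs_mul]
  calc _ ≤ (δ * e + 2 * e * 1) * 32 := by gcongr
    _ = _ := by ring

theorem isComputableSeq_dipTrain {δ : ℝ} (hδ : 0 ≤ δ) {d : ℕ → ℕ} (hd : Computable d)
    (hd' : ∀ k, |δ - (ratOfNat (d k) : ℝ)| ≤ 2 * (1 / 2 ^ k)) {χ : ℕ → ℕ → ℕ → Bool}
    (hχ : Computable fun p : (ℕ × ℕ) × ℕ => χ p.1.1 p.1.2 p.2) :
    IsComputableSeq fun n t => -(δ * dipTrain (fun a => 1 - searchReal (χ n a)) t) := by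
  obtain ⟨D, hD⟩ := pow_unbounded_of_one_lt δ (one_lt_two (α := ℝ))
  have hK : Computable fun k => k + (D + 10) :=
    (Primrec.nat_add.comp Primrec.id (Primrec.const _)).to_comp
  refine isComputableSeq_of_rational_approximation (K := fun k => k + (D + 10))
    (h := fun n k m => codeNegate (codeMul (d (k + (D + 10))) (codeMul
      (codeAdd (dyadicCode 1 0) (codeNegate (dyadicCode 1
        (searchStage (χ n (codeFloor m)) (k + (D + 10))))))
      (codeDipSpeed (codeFract m))))) hK ?_ fun n k m x hx => ?_
  · have hKk : Computable fun p : (ℕ × ℕ) × ℕ => p.1.2 + (D + 10) :=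
      hK.comp (Computable.snd.comp Computable.fst)
    have hstage : Computable fun p : (ℕ × ℕ) × ℕ =>
        searchStage (χ p.1.1 (codeFloor p.2)) (p.1.2 + (D + 10)) := by
      refine computable_searchStage (χ := fun p => χ p.1.1 (codeFloor p.2)) ?_ hKk
      exact hχ.comp (Computable.pair (Computable.pair
        (Computable.fst.comp (Computable.fst.comp Computable.fst))
        (primrec_codeFloor.to_comp.comp (Computable.snd.comp Computable.fst))) Computable.snd)
    exact primrec_codeNegate.to_comp.comp (primrec_codeMul.to_comp.comp (hd.comp hKk)
      (primrec_codeMul.to_comp.comp (primrec_codeAdd.to_comp.comp (Computable.const _)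
        (primrec_codeNegate.to_comp.comp (primrec_dyadicCode.to_comp.comp (Computable.const _)
          hstage))) ((primrec_codeDipSpeed.comp primrec_codeFract).to_comp.comp Computable.snd)))
  · set κ : ℕ → ℝ := fun a => 1 - searchReal (χ n a)
    have hκ : ∀ a, |κ a| ≤ 1 := fun a => abs_le.2
      ⟨by linarith [searchReal_le_one (χ n a)], by linarith [searchReal_nonneg (χ n a)]⟩
    set K := k + (D + 10)
    set s := searchStage (χ n (codeFloor m)) K
    set q : ℝ := ((ratOfNat m : ℚ) : ℝ)
    have hval : (ratOfNat (codeNegate (codeMul (d K) (codeMul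
        (codeAdd (dyadicCode 1 0) (codeNegate (dyadicCode 1 s)))
        (codeDipSpeed (codeFract m))))) : ℝ) =
        -(ratOfNat (d K) * ((1 - 1 / 2 ^ s) * dipSpeed (Int.fract q))) := by
      rw [← ratOfNat_codeFract, ← ratOfNat_codeDipSpeed]
      simp only [ratOfNat_codeMul, ratOfNat_codeAdd, ratOfNat_codeNegate, ratOfNat_dyadicCode]
      push_cast
      ring
    have h1 : |δ * dipTrain κ x - δ * dipTrain κ q| ≤ δ * (512 * (1 / 2 ^ K)) := by
      rw [← mul_sub, abs_mul, abs_of_nonneg hδ]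
      have := (abs_dipTrain_sub_le hκ x q).trans (mul_le_mul_of_nonneg_left hx (by norm_num))
      gcongr
    have hs1 : (1 : ℝ) / 2 ^ s ≤ 1 :=
      div_le_one_of_le₀ (one_le_pow₀ one_le_two) (by positivity)
    have hs0 : (0 : ℝ) ≤ 1 / 2 ^ s := by positivity
    have h2 : |δ * dipTrain κ q - ratOfNat (d K) * ((1 - 1 / 2 ^ s) * dipSpeed (Int.fract q))| ≤
        32 * (δ + 2) * (1 / 2 ^ K) := by
      refine abs_mul_mul_sub_le hδ (hd' K) ?_ (abs_le.2 ⟨by linarith, by linarith⟩) ?_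
      · rw [← codeFloor_eq, sub_sub_sub_cancel_left, abs_sub_comm]
        exact abs_searchReal_sub_le _ K
      · exact (abs_dipSpeed_le (fract_mem_Icc q)).1.trans (by linarith [Int.fract_lt_one q])
    rw [hval, neg_sub_neg, abs_sub_comm]
    refine (abs_sub_le _ (δ * dipTrain κ q) _).trans_lt ((add_le_add h1 h2).trans_lt ?_)
    -- The total error is at most `(544 δ + 64) / 2 ^ K`, and `δ` and `1` are at most `2 ^ D`.
    have hD1 : (1 : ℝ) ≤ 2 ^ D := one_le_pow₀ one_le_two
    have hKe : (1 : ℝ) / 2 ^ k = 2 ^ D * 1024 * (1 / 2 ^ K) := by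
      simp only [K, pow_add]
      field_simp
      norm_num
    rw [hKe]
    have : (0 : ℝ) < 1 / 2 ^ K := by positivity
    nlinarith

/-- Every `Π⁰₂` set is the set of indices where Evader wins, for suitable computable strategies:
Pursuer rests, and in `[a, a + 1]` Evader approaches to the distance `(y₀ - x₀) * 2 ^ (-b)`, where
`b` is the least witness for `a`, or touches Pursuer if there is no witness. -/
theorem exists_strategies_of_isPi02 {x₀ y₀ : ℝ} (hx₀ : IsComputableReal x₀)
    (hy₀ : IsComputableReal y₀) (hxy : x₀ < y₀) {A : Set ℕ} (hA : IsPi02 A) :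
    ∃ u v : ℕ → ℝ → ℝ, IsComputableSeq u ∧ IsComputableSeq v ∧
      {n | EvaderWins x₀ y₀ (u n) (v n)} = A := by
  obtain ⟨χ, hχ, hA⟩ := hA.exists_computable_bool
  obtain ⟨d, hd, hd'⟩ := hx₀.exists_difference hy₀
  refine ⟨fun _ _ => 0, _, ⟨.zero, fun _ _ _ _ _ => ⟨0, Part.mem_some 0, ?_⟩⟩,
    isComputableSeq_dipTrain (sub_pos.2 hxy).le hd hd' hχ, ?_⟩
  · simp [ratOfNat]
  · ext n
    rw [mem_ofPred_eq, evaderWins_dipTrain_iff hxy fun a =>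
      ⟨sub_nonneg.2 (searchReal_le_one _), sub_le_self _ (searchReal_nonneg _)⟩, hA]
    refine forall_congr' fun a => ?_
    rw [sub_lt_self_iff, searchReal_pos_iff]

end PursuitEvasion
open PursuitEvasion in
theorem theorem2 (x₀ y₀ : ℝ) (hx₀ : IsComputableReal x₀) (hy₀ : IsComputableReal y₀)
    (hxy : x₀ < y₀) :
    (∀ u v : ℕ → ℝ → ℝ, IsComputableSeq u → IsComputableSeq v →
      IsPi02 {n | EvaderWins x₀ y₀ (u n) (v n)}) ∧
    ∃ u v : ℕ → ℝ → ℝ, IsComputableSeq u ∧ IsComputableSeq v ∧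
      IsPi02Complete {n | EvaderWins x₀ y₀ (u n) (v n)} ∧
      ¬ ComputablePred (fun n => EvaderWins x₀ y₀ (u n) (v n)) := by
  refine ⟨fun u v hu hv => isPi02_evaderWins hx₀ hy₀ hxy hu hv, ?_⟩
  obtain ⟨u, v, hu, hv, huv⟩ :=
    exists_strategies_of_isPi02 hx₀ hy₀ hxy isPi02Complete_universalPi02.1
  have hcomplete : IsPi02Complete {n | EvaderWins x₀ y₀ (u n) (v n)} :=
    huv ▸ isPi02Complete_universalPi02
  exact ⟨u, v, hu, hv, hcomplete, hcomplete.not_computablePred⟩
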